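/- Let $H$ be a complex Hilbert space and let $M_0,M_1\in L(H)$ be bounded linear operators such that the range $R(M_0)$ is closed. Let $\mathcal M(z)=zM_0+M_1$ $(z\in\mathbb C)$ be the associated linear operator pencil, with spectrum $\sigma(\mathcal M)=\{z : 0\in\sigma(zM_0+M_1)\}$, and assume that $\mathcal M$ is regular (of index $0$): there is $\nu\in\mathbb R$ such that $\mathcal M(z)$ is continuously invertible for all $z$ with $\operatorname{Re}z>\nu$ and $z\mapsto\mathcal M(z)^{-1}$ is bounded on $\{\operatorname{Re}z>\nu\}$. Then $\mathcal M$ admits a strong exponential dichotomy if and only if it admits a mild exponential dichotomy. Moreover, $\mathcal M$ is strongly exponentially stable if and only if it is mildly exponentially stable. Here the following notions are used. Let $\mathcal N$ be the pencil associated with $(M_0,-M_1)$, let $\mathrm{IV}=\{x\in H : M_1x\in R(M_0)\}$, and let $P$ be the orthogonal projection of $H$ onto $N(M_0)^\perp$. For $\rho\in\mathbb R$ and a closed subspace $S\subseteq H$, $L_{2,\rho}(\mathbb R;S)$ is the space of (classes of) measurable $f:\mathbb R\to S$ with $\int_{\mathbb R}|f(t)|^2e^{-2\rho t}\,dt<\infty$,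 and $\mathcal L_\rho:L_{2,\rho}(\mathbb R;H)\to L_2(\mathbb R;H)$ is the unitary extension of $(\mathcal L_\rho\varphi)(t)=\frac1{\sqrt{2\pi}}\int_{\mathbb R}e^{-(it+\rho)s}\varphi(s)\,ds$, $\varphi\in C_c^\infty(\mathbb R;H)$. For $u_0\in H$ put $$S(\mathcal M)u_0=\mathcal L_\rho^{*}\Big(t\mapsto\tfrac1{\sqrt{2\pi}}\,\mathcal M(it+\rho)^{-1}M_0u_0\Big),$$ where $\rho>0$ is so large that $\mathcal M(z)$ is invertible for all $|z|\ge\rho$ with $\sup_{|z|\ge\rho}\|\mathcal M(z)^{-1}\|<\infty$ (the result does not depend on this $\rho$); $S(\mathcal N)u_0$ is defined in the same way. For $u_0\in\mathrm{IV}$, $S(\mathcal M)u_0$ has a representative that is continuous on $[0,\infty)$, and its point values are those of this representative. A closed subspace $S\subseteq\mathrm{IV}$ is invariant under $\mathcal M$ if for each $u_0\in S$ the solution $u$ (continuous on $[0,\infty)$, continuously differentiable on $(0,\infty)$) of $M_0u'(t)+M_1u(t)=0$ $(t>0)$, $u(0)=u_0$, satisfies $u(t)\in S$ for all $t>0$.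 Direct sums are denoted by $\dotplus$. * $\mathcal M$ admits a strong exponential dichotomy (with $S,T$) if there are closed subspaces $S,T\subseteq\mathrm{IV}$, invariant under $\mathcal M$, with $S\dotplus T=\mathrm{IV}$, and constants $\rho,C,c>0$ such that, with $u=S(\mathcal M)u_0$ and for all $t\ge0$, $|u(t)|\le Ce^{-\rho t}|u_0|$ if $u_0\in S$, and $|u(t)|\ge c\,e^{\rho t}|u_0|$ if $u_0\in T$. It is strongly exponentially stable if this holds with $S=\mathrm{IV}$ and $T=\{0\}$. * $\mathcal M$ admits a mild exponential dichotomy (with $S,T$) if there are closed subspaces $S,T\subseteq N(M_0)^\perp$ with $S\dotplus T=N(M_0)^\perp$ and $\rho>0$ such that $P\,S(\mathcal M)u_0\in L_{2,-\rho}(\mathbb R;S)$ for all $u_0\in S$ and $P\,S(\mathcal N)u_0\in L_{2,-\rho}(\mathbb R;T)$ for all $u_0\in T$. It is mildly exponentially stable if this holds with $S=N(M_0)^\perp$ and $T=\{0\}$. -/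

import Mathlib

open MeasureTheory Set
open scoped FourierTransform

noncomputable section

namespace OperatorPencil

variable {H : Type*} [NormedAddCommGroup H] [InnerProductSpace ℂ H] [CompleteSpace H]

/-! ### Linear operator pencils -/

/-- The linear operator pencil `𝓜(z) = z M₀ + M₁` associated with `(M₀, M₁)`. -/
def pencil (M₀ M₁ : H →L[ℂ] H) (z : ℂ) : H →L[ℂ] H := z • M₀ + M₁

/-- The spectrum `σ(𝓜) = {z | 0 ∈ σ(z M₀ + M₁)}` of the pencil. -/
def pencilSpectrum (M₀ M₁ : H →L[ℂ] H) : Set ℂ :=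
  {z | (0 : ℂ) ∈ spectrum ℂ (pencil M₀ M₁ z)}

/-- The resolvent set `ϱ(𝓜) = ℂ \ σ(𝓜)` of the pencil. -/
def pencilResolventSet (M₀ M₁ : H →L[ℂ] H) : Set ℂ := (pencilSpectrum M₀ M₁)ᶜ

/-- `𝓜(z)⁻¹`, a genuine inverse in `L(H)` for `z` in the resolvent set (and `0` elsewhere). -/
def pencilInv (M₀ M₁ : H →L[ℂ] H) (z : ℂ) : H →L[ℂ] H := Ring.inverse (pencil M₀ M₁ z)

/-- The pencil is regular (of index `0`): some half plane `Re z > ν` lies in the resolvent set and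
`z ↦ 𝓜(z)⁻¹` is bounded there. -/
def IsRegularPencil (M₀ M₁ : H →L[ℂ] H) : Prop :=
  ∃ ν : ℝ, (∀ z : ℂ, ν < z.re → z ∈ pencilResolventSet M₀ M₁) ∧
    ∃ K : ℝ, ∀ z : ℂ, ν < z.re → ‖pencilInv M₀ M₁ z‖ ≤ K

/-- `ρ > 0` is large enough for the solution operator: `𝓜(z)` is invertible for all
`z ∈ ℂ \ B(0, ρ)` and `𝓜(z)⁻¹` is bounded there. -/
def IsLargeRadius (M₀ M₁ : H →L[ℂ] H) (ρ : ℝ) : Prop :=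
  0 < ρ ∧ (∀ z : ℂ, z ∉ Metric.ball (0 : ℂ) ρ → z ∈ pencilResolventSet M₀ M₁) ∧
    ∃ K : ℝ, ∀ z : ℂ, z ∉ Metric.ball (0 : ℂ) ρ → ‖pencilInv M₀ M₁ z‖ ≤ K

/-- The space of admissible initial values `IV = {x | M₁ x ∈ R(M₀)} = M₁⁻¹[R(M₀)]`. -/
def initialValues (M₀ M₁ : H →L[ℂ] H) : Submodule ℂ H :=
  (LinearMap.range (M₀ : H →ₗ[ℂ] H)).comap (M₁ : H →ₗ[ℂ] H)

/-- The orthogonal complement `N(M₀)^⊥` of the null space of `M₀`. -/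
def kerPerp (M₀ : H →L[ℂ] H) : Submodule ℂ H := (LinearMap.ker (M₀ : H →ₗ[ℂ] H))ᗮ

/-- The orthogonal projection of `H` onto `N(M₀)^⊥`, regarded as a map `H → H`. -/
def kerPerpProj (M₀ : H →L[ℂ] H) : H →L[ℂ] H :=
  ((LinearMap.ker (M₀ : H →ₗ[ℂ] H))ᗮ).starProjection

/-! ### Weighted `L₂`-spaces and the Fourier-Laplace transform -/

/-- `f` represents an element of `L_{2,ρ}(ℝ; H)`: it is (strongly a.e.) measurable and
`∫ |f(t)|² exp(-2ρt) dt < ∞`. -/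
def MemWeightedL2 (ρ : ℝ) (f : ℝ → H) : Prop :=
  MemLp (fun t : ℝ => Real.exp (-ρ * t) • f t) 2 (volume : Measure ℝ)

/-- `f` represents an element of `L_{2,ρ}(ℝ; S)` for the subspace `S` of `H`. -/
def MemWeightedL2In (ρ : ℝ) (S : Submodule ℂ H) (f : ℝ → H) : Prop :=
  MemWeightedL2 ρ f ∧ ∀ᵐ t ∂(volume : Measure ℝ), f t ∈ S

/-- The Fourier-Laplace transform `𝓛_ρ : L_{2,ρ}(ℝ; H) → L₂(ℝ; H)`, that is, the unitary extension
of `(𝓛_ρ φ)(t) = (2π)^(-1/2) ∫ exp(-(it + ρ)s) φ(s) ds`. As Mathlib's unitary Fourier transform `𝓕`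
on `L₂` has the kernel `exp(-2πi ξ s)`, this is `(2π)^(-1/2) 𝓕(exp(-ρ ·) f)(t / 2π)`. The value is a
representative, determined up to a null set. -/
def fourierLaplace (ρ : ℝ) (f : ℝ → H) (hf : MemWeightedL2 ρ f) : ℝ → H := fun t =>
  (Real.sqrt (2 * Real.pi))⁻¹ •
    (𝓕 (MemLp.toLp (fun t : ℝ => Real.exp (-ρ * t) • f t) hf) : Lp H 2 (volume : Measure ℝ))
      (t / (2 * Real.pi))

/-- On functions `f` for which `exp(-ρ ·) f` is a Schwartz function (for instance on test
functions), the Fourier-Laplace transform is given by the integral formula. -/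
theorem fourierLaplace_ae_eq (ρ : ℝ) (f : ℝ → H) (hf : MemWeightedL2 ρ f)
    (g : SchwartzMap ℝ H) (hg : ∀ t, g t = Real.exp (-ρ * t) • f t) :
    fourierLaplace ρ f hf =ᵐ[volume] fun t : ℝ => (Real.sqrt (2 * Real.pi))⁻¹ •
      ∫ s : ℝ, Complex.exp (-((t : ℂ) * Complex.I + (ρ : ℂ)) * (s : ℂ)) • f s := by
  have h1 : MemLp.toLp (fun t : ℝ => Real.exp (-ρ * t) • f t) hf = g.toLp 2 volume := by
    apply Lp.ext
    refine (MemLp.coeFn_toLp hf).trans ?_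
    refine Filter.EventuallyEq.trans ?_ (SchwartzMap.coeFn_toLp g 2 volume).symm
    exact Filter.Eventually.of_forall fun t => (hg t).symm
  have hpi : (2 * Real.pi) ≠ 0 := by positivity
  have h2 := SchwartzMap.coeFn_toLp (𝓕 g) 2 (volume : Measure ℝ)
  have hq : Measure.QuasiMeasurePreserving (fun t : ℝ => t / (2 * Real.pi)) volume volume := by
    refine ⟨by fun_prop, ?_⟩
    have := Real.map_volume_mul_right (inv_ne_zero hpi)
    simp only [div_eq_mul_inv]
    rw [this]
    exact Measure.smul_absolutelyContinuous
  have h3 := hq.ae_eq_comp h2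
  filter_upwards [h3] with t ht
  simp only [Function.comp] at ht
  unfold fourierLaplace
  rw [h1, SchwartzMap.toLp_fourier_eq, ht, SchwartzMap.fourier_coe, Real.fourier_real_eq_integral_exp_smul]
  congr 1
  refine integral_congr_ae (Filter.Eventually.of_forall fun s => ?_)
  simp only
  rw [hg s, ← Complex.coe_smul, smul_smul, Complex.ofReal_exp, ← Complex.exp_add]
  congr 2
  push_cast
  have : (Real.pi : ℂ) ≠ 0 := by exact_mod_cast Real.pi_ne_zero
  field_simp
  ring

/-! ### Solutions -/

/-- `u` represents `S(𝓜)u₀ = 𝓛_ρ^* (t ↦ (2π)^(-1/2) 𝓜(it + ρ)⁻¹ M₀ u₀) ∈ L_{2,ρ}(ℝ; H)`, where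
`ρ > 0` is large enough. As `𝓛_ρ` is unitary, this says that `u ∈ L_{2,ρ}(ℝ; H)` and that
`(𝓛_ρ u)(t) = (2π)^(-1/2) 𝓜(it + ρ)⁻¹ M₀ u₀` for almost every `t`. -/
def RepresentsSolution (M₀ M₁ : H →L[ℂ] H) (u₀ : H) (u : ℝ → H) : Prop :=
  ∃ ρ : ℝ, IsLargeRadius M₀ M₁ ρ ∧ ∃ hu : MemWeightedL2 ρ u,
    fourierLaplace ρ u hu =ᵐ[volume] fun t : ℝ => (Real.sqrt (2 * Real.pi))⁻¹ •
      pencilInv M₀ M₁ ((t : ℂ) * Complex.I + (ρ : ℂ)) (M₀ u₀)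

/-- `u` is a (strong) solution of `M₀ u'(t) + M₁ u(t) = 0` for `t > 0`, `u(0) = u₀`: it is
continuous on `[0, ∞)` and continuously differentiable on `(0, ∞)`. -/
def IsStrongSolution (M₀ M₁ : H →L[ℂ] H) (u₀ : H) (u : ℝ → H) : Prop :=
  ContinuousOn u (Ici 0) ∧ ContDiffOn ℝ 1 u (Ioi 0) ∧
    (∀ t : ℝ, 0 < t → M₀ (deriv u t) + M₁ (u t) = 0) ∧ u 0 = u₀

/-- The subspace `S` is invariant under `𝓜`: for `u₀ ∈ S`, the strong solution starting in `u₀`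
takes its values in `S`. -/
def IsInvariant (M₀ M₁ : H →L[ℂ] H) (S : Submodule ℂ H) : Prop :=
  ∀ u₀ ∈ S, ∃ u : ℝ → H, IsStrongSolution M₀ M₁ u₀ u ∧ ∀ t : ℝ, 0 < t → u t ∈ S

/-! ### Exponential dichotomies and exponential stability -/

/-- `S` and `T` are closed subspaces with direct sum `S ∔ T = V`. -/
def IsClosedDecomposition (S T V : Submodule ℂ H) : Prop :=
  IsClosed (S : Set H) ∧ IsClosed (T : Set H) ∧ S ⊓ T = ⊥ ∧ S ⊔ T = V

/-- `𝓜` admits a strong exponential dichotomy with the subspaces `S, T ⊆ IV`. Point values of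
`S(𝓜)u₀` are those of its representative that is continuous on `[0, ∞)`. -/
def IsStrongDichotomy (M₀ M₁ : H →L[ℂ] H) (S T : Submodule ℂ H) : Prop :=
  IsClosedDecomposition S T (initialValues M₀ M₁) ∧
    IsInvariant M₀ M₁ S ∧ IsInvariant M₀ M₁ T ∧
    ∃ ρ > (0 : ℝ), ∃ C > (0 : ℝ), ∃ c > (0 : ℝ),
      (∀ u₀ ∈ S, ∃ u : ℝ → H, RepresentsSolution M₀ M₁ u₀ u ∧ ContinuousOn u (Ici 0) ∧
        ∀ t : ℝ, 0 ≤ t → ‖u t‖ ≤ C * Real.exp (-ρ * t) * ‖u₀‖) ∧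
      (∀ u₀ ∈ T, ∃ u : ℝ → H, RepresentsSolution M₀ M₁ u₀ u ∧ ContinuousOn u (Ici 0) ∧
        ∀ t : ℝ, 0 ≤ t → c * Real.exp (ρ * t) * ‖u₀‖ ≤ ‖u t‖)

/-- `𝓜` admits a strong exponential dichotomy. -/
def AdmitsStrongDichotomy (M₀ M₁ : H →L[ℂ] H) : Prop :=
  ∃ S T : Submodule ℂ H, IsStrongDichotomy M₀ M₁ S T

/-- `𝓜` is strongly exponentially stable: strong dichotomy with `S = IV` and `T = {0}`. -/
def IsStronglyExpStable (M₀ M₁ : H →L[ℂ] H) : Prop :=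
  IsStrongDichotomy M₀ M₁ (initialValues M₀ M₁) ⊥

/-- `𝓜` admits a mild exponential dichotomy with the subspaces `S, T ⊆ N(M₀)^⊥`. The second
condition concerns the pencil `𝓝` associated with `(M₀, -M₁)`. -/
def IsMildDichotomy (M₀ M₁ : H →L[ℂ] H) (S T : Submodule ℂ H) : Prop :=
  IsClosedDecomposition S T (kerPerp M₀) ∧
    ∃ ρ > (0 : ℝ),
      (∀ u₀ ∈ S, ∃ u : ℝ → H, RepresentsSolution M₀ M₁ u₀ u ∧
        MemWeightedL2In (-ρ) S (fun t => kerPerpProj M₀ (u t))) ∧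
      (∀ u₀ ∈ T, ∃ u : ℝ → H, RepresentsSolution M₀ (-M₁) u₀ u ∧
        MemWeightedL2In (-ρ) T (fun t => kerPerpProj M₀ (u t)))

/-- `𝓜` admits a mild exponential dichotomy. -/
def AdmitsMildDichotomy (M₀ M₁ : H →L[ℂ] H) : Prop :=
  ∃ S T : Submodule ℂ H, IsMildDichotomy M₀ M₁ S T

/-- `𝓜` is mildly exponentially stable: mild dichotomy with `S = N(M₀)^⊥` and `T = {0}`. -/
def IsMildlyExpStable (M₀ M₁ : H →L[ℂ] H) : Prop :=
  IsMildDichotomy M₀ M₁ (kerPerp M₀) ⊥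

end OperatorPencil

end

/-! Regularity and closed range turn the pencil into an ordinary differential equation with bounded
generator. Let `J` be a generalized inverse with `J M₀ = P`. In the resolvent identity `g(z) - g(w)
= (w - z) g(z) M₀ g(w)` for `g = 𝓜⁻¹`, insert `M₀ = M₀ J M₀`; boundedness of `g` makes `g M₀` and
`M₀ g` of order `1/z`, so `g(n)` is Cauchy with a limit `D` (`exists_tendsto_inverse`). Then `E = 1
- D M₁` projects onto `IV` along `N(M₀)`, and `(z M₀ + M₁) E = M₀ (z + B)` for the bounded operator
`B = E J M₁ E`.

Hence strong solutions are the orbits `exp(-tB) u₀` with `u₀ ∈ IV`, and taking Laplace transforms,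
`S(𝓜)u₀` is `exp(-tB) E u₀` on `[0, ∞)` and zero before (`fourierLaplace_causalFlow`). Passing to
`𝓝` replaces `B` by `-B` and keeps `E`, so `S(𝓝)` is the backward flow.

Since `P E = P` and `E P = E`, the maps `P : IV → N(M₀)^⊥` and `E : N(M₀)^⊥ → IV` are mutually
inverse and carry strong splittings to mild ones and back. Two facts remain. Forward growth on `T`
is backward decay on `T`, because a closed subspace invariant under the forward flow is invariant
under the whole group. Exponential decay gives weighted square integrability at a smaller rate;
conversely, square integrability of every orbit gives a bound on each orbit, and uniform boundedness
makes the bound uniform. -/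

noncomputable section

namespace OperatorPencil

/-! ### Algebraic reduction of the pencil to a bounded generator -/

section Splitting

/-- Algebraic data reducing the pencil `z M₀ + M₁` to an ordinary differential equation: a
generalized inverse `J` of `M₀` and the limit `D` of `(z M₀ + M₁)⁻¹` as `z → ∞`. -/
structure PencilSplitting {R : Type*} [Ring R] (M₀ M₁ : R) where
  J : R
  D : R
  mul_J_mul : M₀ * J * M₀ = M₀
  mul_D : M₀ * D = 0
  D_mul : D * M₀ = 0
  corange : (1 - M₀ * J) * M₁ * D = 1 - M₀ * J
  kernel : D * M₁ * (1 - J * M₀) = 1 - J * M₀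

namespace PencilSplitting

variable {R : Type*} [Ring R] {M₀ M₁ : R} (s : PencilSplitting M₀ M₁)

/-- The projection onto the admissible initial values along the kernel of `M₀`. -/
def E : R := 1 - s.D * M₁

/-- The generator of the reduced equation `u' + B u = 0`. -/
def B : R := s.E * s.J * M₁ * s.E

/-- The splitting of the pencil associated with `(M₀, -M₁)`. -/
def neg : PencilSplitting M₀ (-M₁) where
  J := s.J
  D := -s.D
  mul_J_mul := s.mul_J_mul
  mul_D := by simp [s.mul_D]
  D_mul := by simp [s.D_mul]
  corange := by simpa using s.corange
  kernel := by simpa using s.kernel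

theorem neg_E : s.neg.E = s.E := by simp [neg, E]

theorem neg_B : s.neg.B = -s.B := by
  simp only [B, neg_E]
  simp [neg]

theorem M₀_mul_E : M₀ * s.E = M₀ := by
  simp [E, mul_sub, ← mul_assoc, s.mul_D]

theorem E_mul_J_mul : s.E * (s.J * M₀) = s.E := by
  have h := s.kernel
  simp only [E, mul_sub, sub_mul, mul_one, one_mul] at h ⊢
  rw [← sub_eq_zero] at h ⊢
  rw [← h]; abel

theorem J_mul_E : s.J * M₀ * s.E = s.J * M₀ := by rw [mul_assoc, s.M₀_mul_E]

theorem E_mul_E : s.E * s.E = s.E := by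
  calc s.E * s.E = s.E * (s.J * M₀) * s.E := by rw [s.E_mul_J_mul]
    _ = s.E := by rw [mul_assoc, s.J_mul_E, s.E_mul_J_mul]

theorem E_mul_B : s.E * s.B = s.B := by simp only [B, ← mul_assoc, s.E_mul_E]

theorem B_mul_E : s.B * s.E = s.B := by simp only [B, mul_assoc, s.E_mul_E]

/-- As `M₀ J` projects onto `R(M₀)`, this expresses that `E` takes values in `IV`. -/
theorem corange_M₁_mul_E : M₀ * s.J * (M₁ * s.E) = M₁ * s.E := by
  have h : (1 - M₀ * s.J) * M₁ * s.E = 0 := by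
    rw [E, mul_sub, mul_one, ← mul_assoc, s.corange, sub_self]
  rw [sub_mul, sub_mul, one_mul, sub_eq_zero] at h
  rw [← mul_assoc]; exact h.symm

theorem M₀_mul_B : M₀ * s.B = M₁ * s.E := by
  rw [B, mul_assoc, mul_assoc, ← mul_assoc, s.M₀_mul_E, ← mul_assoc, s.corange_M₁_mul_E]

theorem D_mul_M₁ : s.D * M₁ = 1 - s.E := by simp [E]

variable {𝕜 : Type*} [Field 𝕜] [Algebra 𝕜 R]

/-- The reduction itself: up to the factor `M₀`, the pencil acts on `IV` as `z + B`. Both directions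
between inverses of the pencil and resolvents of `-B` rest on it. -/
theorem pencil_mul_E (z : 𝕜) : (z • M₀ + M₁) * s.E = M₀ * (z • 1 + s.B) := by
  rw [add_mul, smul_mul_assoc, s.M₀_mul_E, mul_add, s.M₀_mul_B, mul_smul_comm, mul_one]

/-- The inverse of the pencil in terms of the resolvent `r` of the reduced generator. -/
def inverse (r : R) : R := s.D + s.E * r * s.J * (1 - M₁ * s.D)

theorem pencil_mul_inverse (z : 𝕜) {r : R} (hr : (z • 1 + s.B) * r = 1) :
    (z • M₀ + M₁) * s.inverse r = 1 := by
  have h1 : (z • M₀ + M₁) * s.D = M₁ * s.D := by simp [add_mul, s.mul_D]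
  have h2 : (z • M₀ + M₁) * (s.E * r * s.J * (1 - M₁ * s.D)) = M₀ * s.J * (1 - M₁ * s.D) := by
    simp only [← mul_assoc]
    rw [s.pencil_mul_E, mul_assoc M₀, hr, mul_one]
  have h3 : M₀ * s.J * (M₁ * s.D) = M₁ * s.D - 1 + M₀ * s.J := by
    have := s.corange
    rw [sub_mul, sub_mul, one_mul, sub_eq_iff_eq_add] at this
    rw [← mul_assoc, this]; abel
  rw [inverse, mul_add, h1, h2, mul_sub, h3]
  noncomm_ring

theorem inverse_mul_pencil (z : 𝕜) {r : R} (hr : (z • 1 + s.B) * r = 1)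
    (hr' : r * (z • 1 + s.B) = 1) : s.inverse r * (z • M₀ + M₁) = 1 := by
  have hc : s.E * (z • 1 + s.B) = (z • 1 + s.B) * s.E := by
    rw [mul_add, add_mul, s.E_mul_B, s.B_mul_E]; simp
  have hcr : s.E * r = r * s.E := by
    calc s.E * r = r * (z • 1 + s.B) * s.E * r := by rw [hr', one_mul]
      _ = r * (s.E * (z • 1 + s.B)) * r := by rw [hc, mul_assoc r]
      _ = r * s.E := by rw [mul_assoc, mul_assoc, hr, mul_one]
  have h1 : s.D * (z • M₀ + M₁) = 1 - s.E := by simp [mul_add, s.D_mul, s.D_mul_M₁]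
  have h2 : (1 - M₁ * s.D) * (z • M₀ + M₁) = z • M₀ + M₁ * s.E := by
    rw [sub_mul, one_mul, mul_assoc, h1, mul_sub, mul_one]; abel
  have h3 : s.E * s.J * (z • M₀ + M₁ * s.E) = (z • 1 + s.B) * s.E := by
    rw [mul_add, mul_smul_comm, mul_assoc s.E, s.E_mul_J_mul, ← mul_assoc, ← B, add_mul, s.B_mul_E]
    simp
  rw [inverse, add_mul, h1, mul_assoc _ (1 - M₁ * s.D), h2, hcr, mul_assoc r, mul_assoc r, h3,
    ← mul_assoc, hr', one_mul, sub_add_cancel]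

/-- `z + B` is multiplication by `z` on the kernel of `E`, and on the range of `E` it is inverted by
`g M₀`. Invertibility of the pencil thus passes to `z + B`, which confines the spectrum of `-B` to
the ball in the definition of a large radius. -/
theorem resolvent_mul (z : 𝕜) (hz : z ≠ 0) {g : R} (hg : g * (z • M₀ + M₁) = 1)
    (hg' : (z • M₀ + M₁) * g = 1) :
    (z⁻¹ • (1 - s.E) + g * M₀) * (z • 1 + s.B) = 1 ∧
      (z • 1 + s.B) * (z⁻¹ • (1 - s.E) + g * M₀) = 1 := by
  have h1 : (1 - s.E) * (z • 1 + s.B) = z • (1 - s.E) := by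
    rw [mul_add, sub_mul _ _ s.B, s.E_mul_B]; simp
  have h2 : (z • 1 + s.B) * (1 - s.E) = z • (1 - s.E) := by
    rw [add_mul, mul_sub s.B, s.B_mul_E]; simp
  have h3 : g * M₀ * (z • 1 + s.B) = s.E := by
    rw [mul_assoc, ← s.pencil_mul_E, ← mul_assoc, hg, one_mul]
  have h4 : s.E * (g * M₀) = g * M₀ := by
    have : s.D * M₁ * (g * M₀) = 0 := by
      calc s.D * M₁ * (g * M₀) = s.D * (z • M₀ + M₁) * (g * M₀) := by
            rw [mul_add, mul_smul_comm, s.D_mul, smul_zero, zero_add]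
        _ = s.D * ((z • M₀ + M₁) * g) * M₀ := by simp only [mul_assoc]
        _ = 0 := by rw [hg', mul_one, s.D_mul]
    rw [E, sub_mul, this, one_mul, sub_zero]
  have hc : s.E * (z • 1 + s.B) = (z • 1 + s.B) * s.E := by
    rw [mul_add, add_mul, s.E_mul_B, s.B_mul_E]; simp
  have h5 : M₀ * ((z • 1 + s.B) * (g * M₀)) = M₀ := by
    rw [← mul_assoc, ← s.pencil_mul_E, mul_assoc, h4, ← mul_assoc, hg', one_mul]
  have h6 : (z • 1 + s.B) * (g * M₀) = s.E := by
    calc (z • 1 + s.B) * (g * M₀) = s.E * ((z • 1 + s.B) * (g * M₀)) := by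
          rw [← mul_assoc s.E, hc, mul_assoc _ s.E, h4]
      _ = s.E * (s.J * M₀) * ((z • 1 + s.B) * (g * M₀)) := by rw [s.E_mul_J_mul]
      _ = s.E * s.J * (M₀ * ((z • 1 + s.B) * (g * M₀))) := by simp only [mul_assoc]
      _ = s.E := by rw [h5, mul_assoc, s.E_mul_J_mul]
  constructor
  · rw [add_mul, smul_mul_assoc, h1, h3, smul_smul, inv_mul_cancel₀ hz, one_smul, sub_add_cancel]
  · rw [mul_add, mul_smul_comm, h2, h6, smul_smul, inv_mul_cancel₀ hz, one_smul, sub_add_cancel]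

end PencilSplitting

theorem mem_pencilResolventSet_iff {H : Type*} [NormedAddCommGroup H] [InnerProductSpace ℂ H]
    (M₀ M₁ : H →L[ℂ] H) (z : ℂ) :
    z ∈ pencilResolventSet M₀ M₁ ↔ IsUnit (pencil M₀ M₁ z) := by
  simp [pencilResolventSet, pencilSpectrum, spectrum.zero_mem_iff]

/-! ### Existence of the generalized inverse and of the limit at infinity -/

section Existence

variable {H : Type*} [NormedAddCommGroup H] [InnerProductSpace ℂ H] [CompleteSpace H]

theorem M₀_mul_kerPerpProj (M₀ : H →L[ℂ] H) : M₀ * kerPerpProj M₀ = M₀ := by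
  ext x
  have hker : IsClosed ((LinearMap.ker (M₀ : H →ₗ[ℂ] H) : Submodule ℂ H) : Set H) :=
    M₀.isClosed_ker
  have : CompleteSpace (LinearMap.ker (M₀ : H →ₗ[ℂ] H)) := hker.completeSpace_coe
  have h : x - kerPerpProj M₀ x ∈ LinearMap.ker (M₀ : H →ₗ[ℂ] H) := by
    have := (LinearMap.ker (M₀ : H →ₗ[ℂ] H))ᗮ.sub_starProjection_mem_orthogonal x
    rwa [Submodule.orthogonal_orthogonal] at this
  have : M₀ (x - kerPerpProj M₀ x) = 0 := h
  rw [map_sub, sub_eq_zero] at this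
  exact this.symm

/-- `M₀` maps `N(M₀)^⊥` bijectively onto its range, which is complete because it is closed; the open
mapping theorem inverts this restriction, and `J` precedes the inverse by the orthogonal projection
onto the range. -/
theorem exists_generalizedInverse (M₀ : H →L[ℂ] H) (hclosed : IsClosed (Set.range M₀)) :
    ∃ J : H →L[ℂ] H, J * M₀ = kerPerpProj M₀ := by
  set K := (LinearMap.ker (M₀ : H →ₗ[ℂ] H))ᗮ
  set R := LinearMap.range (M₀ : H →ₗ[ℂ] H) with hR
  have hRc : IsClosed (R : Set H) := by
    have h : (R : Set H) = Set.range M₀ := by ext; simp [hR]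
    rwa [h]
  have : CompleteSpace R := hRc.completeSpace_coe
  have : CompleteSpace K := (Submodule.isClosed_orthogonal _).completeSpace_coe
  have hproj : ∀ x, M₀ (K.starProjection x) = M₀ x := fun x =>
    congrArg (fun T : H →L[ℂ] H => T x) (M₀_mul_kerPerpProj M₀)
  let T : K →L[ℂ] R := (M₀ ∘L K.subtypeL).codRestrict R (fun x => ⟨x, rfl⟩)
  have hinj : Function.Injective T := by
    rw [injective_iff_map_eq_zero]
    intro x hx
    have h0 : M₀ x = 0 := congrArg Subtype.val hx
    have h1 : inner ℂ (x : H) (x : H) = 0 := (Submodule.mem_orthogonal _ _).1 x.2 x h0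
    exact Subtype.ext (inner_self_eq_zero.1 h1)
  have hsurj : Function.Surjective T := by
    rintro ⟨_, x, rfl⟩
    exact ⟨K.orthogonalProjectionOnto x, Subtype.ext (hproj x)⟩
  let e := ContinuousLinearEquiv.ofBijective T (LinearMap.ker_eq_bot.2 hinj)
    (LinearMap.range_eq_top.2 hsurj)
  refine ⟨K.subtypeL ∘L (e.symm : R →L[ℂ] K) ∘L R.orthogonalProjectionOnto, ?_⟩
  ext x
  have h1 : R.orthogonalProjectionOnto (M₀ x) = e (K.orthogonalProjectionOnto x) := by
    apply Subtype.ext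
    rw [show ((e (K.orthogonalProjectionOnto x) : R) : H) = M₀ x from hproj x]
    exact congrArg Subtype.val
      (Submodule.orthogonalProjectionOnto_mem_subspace_eq_self (K := R) ⟨M₀ x, x, rfl⟩)
  simp [h1]
  rfl

/-- The inverses `g n` of `a n • M₀ + M₁` converge as `a n → ∞` when they stay bounded. -/
theorem exists_tendsto_inverse {R : Type*} [NormedRing R] [NormedAlgebra ℂ R] [CompleteSpace R]
    {M₀ M₁ J : R} (hJ : M₀ * J * M₀ = M₀) {K : ℝ} {N : ℕ} (hN : 0 < N) {g : ℕ → R}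
    (hl : ∀ n, g n * (((n + N : ℕ) : ℂ) • M₀ + M₁) = 1)
    (hr : ∀ n, (((n + N : ℕ) : ℂ) • M₀ + M₁) * g n = 1) (hK : ∀ n, ‖g n‖ ≤ K) :
    ∃ D, Filter.Tendsto g Filter.atTop (nhds D) := by
  set a : ℕ → ℂ := fun n => ((n + N : ℕ) : ℂ) with ha
  have ha0 : ∀ n, a n ≠ 0 := fun n => by simp only [ha]; exact_mod_cast (by omega)
  have h1 : ∀ n, g n * M₀ = (a n)⁻¹ • (1 - g n * M₁) := fun n => by
    have := hl n
    rw [mul_add, mul_smul_comm] at this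
    rw [← this, add_sub_cancel_right, smul_smul, inv_mul_cancel₀ (ha0 n), one_smul]
  have h2 : ∀ n, M₀ * g n = (a n)⁻¹ • (1 - M₁ * g n) := fun n => by
    have := hr n
    rw [add_mul, smul_mul_assoc] at this
    rw [← this, add_sub_cancel_right, smul_smul, inv_mul_cancel₀ (ha0 n), one_smul]
  -- The resolvent identity with `M₀ = M₀ J M₀`: the outer factors `g m M₀` and `M₀ g n` contribute
  -- `(a m)⁻¹ (a n)⁻¹`, which turns `a n - a m` into a difference of reciprocals.
  have h3 : ∀ m n, g m - g n =
      ((a m)⁻¹ - (a n)⁻¹) • ((1 - g m * M₁) * J * (1 - M₁ * g n)) := fun m n => by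
    calc g m - g n = g m * ((a n • M₀ + M₁) * g n) - g m * (a m • M₀ + M₁) * g n := by
          rw [hl, hr]; simp
      _ = (a n - a m) • (g m * (M₀ * J * M₀) * g n) := by
          rw [hJ, sub_smul]; simp only [add_mul, mul_add, smul_mul_assoc, mul_smul_comm, mul_assoc]
          abel
      _ = (a n - a m) • ((g m * M₀) * J * (M₀ * g n)) := by simp only [mul_assoc]
      _ = _ := by
          rw [h1, h2]
          simp only [smul_mul_assoc, mul_smul_comm, smul_smul]
          congr 1
          have := ha0 n
          have := ha0 m
          field_simp
  have hK0 : 0 ≤ K := (norm_nonneg _).trans (hK 0)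
  set C := (‖(1 : R)‖ + K * ‖M₁‖) * ‖J‖ * (‖(1 : R)‖ + ‖M₁‖ * K) with hC
  have hC0 : 0 ≤ C := by positivity
  have h4 : ∀ m n, ‖(1 - g m * M₁) * J * (1 - M₁ * g n)‖ ≤ C := fun m n => by
    have e1 : ‖1 - g m * M₁‖ ≤ ‖(1 : R)‖ + K * ‖M₁‖ :=
      (norm_sub_le _ _).trans (by gcongr; exact (norm_mul_le _ _).trans (by gcongr; exact hK m))
    have e2 : ‖1 - M₁ * g n‖ ≤ ‖(1 : R)‖ + ‖M₁‖ * K :=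
      (norm_sub_le _ _).trans (by gcongr; exact (norm_mul_le _ _).trans (by gcongr; exact hK n))
    refine (norm_mul_le _ _).trans ?_
    rw [hC]
    gcongr
    exact (norm_mul_le _ _).trans (by gcongr)
  have ht : Filter.Tendsto (fun n => ‖(a n)⁻¹‖ ) Filter.atTop (nhds 0) := by
    have h := (tendsto_inv_atTop_nhds_zero_nat (𝕜 := ℝ)).comp (Filter.tendsto_add_atTop_nat N)
    refine h.congr fun n => ?_
    simp only [ha, norm_inv, Complex.norm_natCast, Function.comp]
  refine cauchySeq_tendsto_of_complete
    (cauchySeq_of_le_tendsto_0 (fun n => 2 * ‖(a n)⁻¹‖ * C) ?_ ?_)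
  · have hmono : ∀ n k, k ≤ n → ‖(a n)⁻¹‖ ≤ ‖(a k)⁻¹‖ := fun n k hk => by
      simp only [ha, norm_inv, Complex.norm_natCast]
      gcongr
    intro n m k hn hm
    rw [dist_eq_norm, h3, norm_smul]
    gcongr
    · exact (norm_sub_le _ _).trans (by linarith [hmono n k hn, hmono m k hm])
    · exact h4 n m
  · simpa using (ht.const_mul 2).mul_const C

theorem exists_pencilSplitting (M₀ M₁ : H →L[ℂ] H) (hreg : IsRegularPencil M₀ M₁)
    (hclosed : IsClosed (Set.range M₀)) :
    ∃ s : PencilSplitting M₀ M₁, s.J * M₀ = kerPerpProj M₀ := by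
  obtain ⟨J, hJ⟩ := exists_generalizedInverse M₀ hclosed
  have hJ' : M₀ * J * M₀ = M₀ := by rw [mul_assoc, hJ, M₀_mul_kerPerpProj]
  obtain ⟨ν, hν, K, hK⟩ := hreg
  obtain ⟨N, hN⟩ := exists_nat_gt (max ν 0)
  have hN0 : 0 < N := by exact_mod_cast (le_max_right ν 0).trans_lt hN
  have hre : ∀ n : ℕ, ν < (((n + N : ℕ) : ℂ)).re := fun n => by
    rw [Complex.natCast_re]; push_cast
    have := (le_max_left ν 0).trans_lt hN
    have : (0 : ℝ) ≤ n := n.cast_nonneg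
    linarith
  have hu := fun n => (mem_pencilResolventSet_iff M₀ M₁ _).1 (hν _ (hre n))
  have hl : ∀ n : ℕ, pencilInv M₀ M₁ ((n + N : ℕ) : ℂ) * (((n + N : ℕ) : ℂ) • M₀ + M₁) = 1 :=
    fun n => Ring.inverse_mul_cancel _ (hu n)
  have hr : ∀ n : ℕ, (((n + N : ℕ) : ℂ) • M₀ + M₁) * pencilInv M₀ M₁ ((n + N : ℕ) : ℂ) = 1 :=
    fun n => Ring.mul_inverse_cancel _ (hu n)
  obtain ⟨D, hD⟩ := exists_tendsto_inverse hJ' hN0 hl hr (fun n => hK _ (hre n))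
  set g := fun n : ℕ => pencilInv M₀ M₁ ((n + N : ℕ) : ℂ) with hg
  have ht : Filter.Tendsto (fun n : ℕ => (((n + N : ℕ) : ℂ))⁻¹) Filter.atTop (nhds 0) :=
    (tendsto_inv_atTop_nhds_zero_nat (𝕜 := ℂ)).comp (Filter.tendsto_add_atTop_nat N)
  have ha0 : ∀ n : ℕ, ((n + N : ℕ) : ℂ) ≠ 0 := fun n => by exact_mod_cast (by omega)
  have lim1 : Filter.Tendsto (fun n => M₀ * g n) Filter.atTop (nhds 0) := by
    have := ht.smul (tendsto_const_nhds.sub (hD.const_mul M₁) :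
      Filter.Tendsto (fun n => 1 - M₁ * g n) _ (nhds (1 - M₁ * D)))
    rw [zero_smul] at this
    refine this.congr fun n => ?_
    have h := hr n
    rw [add_mul, smul_mul_assoc] at h
    rw [← h, hg, add_sub_cancel_right, smul_smul, inv_mul_cancel₀ (ha0 n), one_smul]
  have lim2 : Filter.Tendsto (fun n => g n * M₀) Filter.atTop (nhds 0) := by
    have := ht.smul (tendsto_const_nhds.sub (hD.mul_const M₁) :
      Filter.Tendsto (fun n => 1 - g n * M₁) _ (nhds (1 - D * M₁)))
    rw [zero_smul] at this
    refine this.congr fun n => ?_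
    have h := hl n
    rw [mul_add, mul_smul_comm] at h
    rw [← h, hg, add_sub_cancel_right, smul_smul, inv_mul_cancel₀ (ha0 n), one_smul]
  refine ⟨⟨J, D, hJ', tendsto_nhds_unique (hD.const_mul M₀) lim1,
    tendsto_nhds_unique (hD.mul_const M₀) lim2, ?_, ?_⟩, hJ⟩
  -- Since `1 - M₀ J` annihilates the growing term `a n M₀`, the identity already holds with `g n`
  -- in place of `D`; the last field is obtained symmetrically.
  · refine tendsto_nhds_unique (hD.const_mul ((1 - M₀ * J) * M₁)) ?_
    refine tendsto_const_nhds.congr fun n => ?_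
    have h0 : (1 - M₀ * J) * M₀ = 0 := by rw [sub_mul, one_mul, hJ', sub_self]
    calc 1 - M₀ * J = (1 - M₀ * J) * ((((n + N : ℕ) : ℂ) • M₀ + M₁) * g n) := by
          rw [hr, mul_one]
      _ = _ := by rw [← mul_assoc, mul_add, mul_smul_comm, h0, smul_zero, zero_add]
  · refine tendsto_nhds_unique ((hD.mul_const M₁).mul_const (1 - J * M₀)) ?_
    refine tendsto_const_nhds.congr fun n => ?_
    have h0 : M₀ * (1 - J * M₀) = 0 := by rw [mul_sub, mul_one, ← mul_assoc, hJ', sub_self]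
    calc 1 - J * M₀ = (g n * (((n + N : ℕ) : ℂ) • M₀ + M₁)) * (1 - J * M₀) := by
          rw [hl, one_mul]
      _ = _ := by
          rw [mul_assoc, add_mul, smul_mul_assoc, h0, smul_zero, zero_add, mul_assoc]

end Existence

end Splitting

/-! ### The group generated by a bounded operator -/

section FlowGroup

section Flow

variable {A : Type*} [NormedRing A] [NormedAlgebra ℂ A]

/-- The group `exp(-tB)` generated by `-B`. -/
def flow (B : A) (t : ℝ) : A := NormedSpace.exp ((t : ℂ) • (-B))

theorem flow_zero (B : A) : flow B 0 = 1 := by simp [flow]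

theorem flow_neg_left (B : A) (t : ℝ) : flow (-B) t = flow B (-t) := by simp [flow]

theorem flow_commute {B X : A} (h : Commute X B) (t : ℝ) : Commute X (flow B t) :=
  Commute.exp_right ((h.neg_right).smul_right (t : ℂ))

variable [CompleteSpace A]

theorem hasDerivAt_flow (B : A) (t : ℝ) : HasDerivAt (flow B) (-B * flow B t) t :=
  ((hasDerivAt_exp_smul_const' (-B) (t : ℂ)).scomp t
    Complex.ofRealCLM.hasDerivAt).congr_deriv (by simp [flow])

theorem continuous_flow (B : A) : Continuous (flow B) :=
  continuous_iff_continuousAt.2 fun t => (hasDerivAt_flow B t).continuousAt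

theorem flow_add (B : A) (s t : ℝ) : flow B (s + t) = flow B s * flow B t := by
  rw [flow, flow, flow, ← NormedSpace.exp_add_of_commute_of_mem_ball (𝕂 := ℂ)]
  · push_cast; rw [add_smul]
  · exact ((Commute.refl (-B)).smul_left _).smul_right _
  · rw [NormedSpace.expSeries_radius_eq_top]; exact edist_lt_top _ _
  · rw [NormedSpace.expSeries_radius_eq_top]; exact edist_lt_top _ _

theorem flow_neg_mul_flow (B : A) (t : ℝ) : flow B (-t) * flow B t = 1 := by
  rw [← flow_add, neg_add_cancel, flow_zero]

theorem flow_mul_flow_neg (B : A) (t : ℝ) : flow B t * flow B (-t) = 1 := by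
  rw [← flow_add, add_neg_cancel, flow_zero]

theorem hasSum_flow (B : A) (t : ℝ) :
    HasSum (fun n : ℕ => ((n.factorial : ℂ))⁻¹ • ((t : ℂ) • (-B)) ^ n) (flow B t) :=
  NormedSpace.exp_series_hasSum_exp' (𝕂 := ℂ) _

theorem norm_flow_le_of_norm_pow_le {B : A} {C r : ℝ} (h : ∀ n, ‖B ^ n‖ ≤ C * r ^ n) (t : ℝ) :
    ‖flow B t‖ ≤ C * Real.exp (r * |t|) := by
  have h1 : HasSum (fun n : ℕ => C * ((r * |t|) ^ n / n.factorial)) (C * Real.exp (r * |t|)) := by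
    rw [Real.exp_eq_exp_ℝ]
    exact (NormedSpace.expSeries_div_hasSum_exp (r * |t|)).mul_left C
  refine (hasSum_flow B t).norm_le_of_bounded h1 fun n => ?_
  have h2 : ‖((t : ℂ) • (-B)) ^ n‖ = |t| ^ n * ‖B ^ n‖ := by
    rw [smul_pow, norm_smul, norm_pow, Complex.norm_real, Real.norm_eq_abs]
    rcases n.even_or_odd with h | h <;> simp [h.neg_pow]
  rw [norm_smul, norm_inv, Complex.norm_natCast, h2]
  calc ((n.factorial : ℝ))⁻¹ * (|t| ^ n * ‖B ^ n‖)
      ≤ ((n.factorial : ℝ))⁻¹ * (|t| ^ n * (C * r ^ n)) := by gcongr; exact h n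
    _ = _ := by rw [mul_pow]; ring

theorem exists_norm_flow_le (B : A) : ∃ C, 0 ≤ C ∧ ∀ t, ‖flow B t‖ ≤ C * Real.exp (‖B‖ * |t|) := by
  refine ⟨max ‖(1 : A)‖ 1, by positivity, norm_flow_le_of_norm_pow_le fun n => ?_⟩
  rcases n.eq_zero_or_pos with rfl | hn
  · simp
  · exact (norm_pow_le' B hn).trans (le_mul_of_one_le_left (by positivity) (le_max_right _ _))

/-- Compactness of the spectrum makes the spectral radius strictly smaller than `ρ`, and Gelfand's
formula bounds the powers. The bound by `‖B‖` would not do: the weight `ρ` in a representation of a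
solution may lie below `‖B‖`. -/
theorem exists_norm_pow_le {B : A} {ρ : ℝ} (hρ : 0 < ρ)
    (h : ∀ z : ℂ, ρ ≤ ‖z‖ → IsUnit (z • (1 : A) + B)) :
    ∃ r, r < ρ ∧ ∃ C, 0 ≤ C ∧ ∀ n, ‖B ^ n‖ ≤ C * r ^ n := by
  rcases subsingleton_or_nontrivial A with hA | hA
  · exact ⟨0, hρ, 0, le_rfl, fun n => by simp [Subsingleton.elim (B ^ n) 0]⟩
  have h1 : spectralRadius ℂ B < ENNReal.ofNNReal ⟨ρ, hρ.le⟩ := by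
    refine spectrum.spectralRadius_lt_of_forall_lt B (r := ⟨ρ, hρ.le⟩) fun z hz => ?_
    by_contra hcon
    refine hz ?_
    have h2 : ρ ≤ ‖-z‖ := by rw [norm_neg]; exact_mod_cast not_lt.1 hcon
    have h3 := (h (-z) h2).neg
    rwa [neg_add, neg_smul, neg_neg, ← Algebra.algebraMap_eq_smul_one, ← sub_eq_add_neg] at h3
  obtain ⟨r, hr1, hr2⟩ := ENNReal.lt_iff_exists_nnreal_btwn.1 h1
  have hr0 : 0 < r := by
    have := (zero_le (a := spectralRadius ℂ B)).trans_lt hr1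
    exact_mod_cast this
  have h4 := (spectrum.pow_nnnorm_pow_one_div_tendsto_nhds_spectralRadius B).eventually_lt_const hr1
  obtain ⟨N, hN⟩ := Filter.eventually_atTop.1 h4
  -- Starting at `N + 1` excludes `n = 0`, where the `n`-th root is meaningless; the finitely many
  -- earlier powers are absorbed in the constant.
  have h5 : ∀ n, N + 1 ≤ n → ‖B ^ n‖ ≤ (r : ℝ) ^ n := fun n hn => by
    have h6 := (hN n (by omega)).le
    have hn0 : (n : ℝ) ≠ 0 := by exact_mod_cast (by omega)
    have h7 := ENNReal.rpow_le_rpow h6 (n.cast_nonneg : (0 : ℝ) ≤ n)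
    rw [← ENNReal.rpow_mul, one_div, inv_mul_cancel₀ hn0, ENNReal.rpow_one, ENNReal.rpow_natCast]
      at h7
    exact_mod_cast h7
  have hr0' : (0 : ℝ) < r := hr0
  refine ⟨r, ENNReal.coe_lt_coe.1 hr2, 1 + ∑ n ∈ Finset.range (N + 1), ‖B ^ n‖ / (r : ℝ) ^ n,
    by positivity, fun n => ?_⟩
  by_cases hn : N + 1 ≤ n
  · refine (h5 n hn).trans (le_mul_of_one_le_left (by positivity) ?_)
    rw [le_add_iff_nonneg_right]; positivity
  · rw [← div_le_iff₀ (by positivity)]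
    have := Finset.single_le_sum (f := fun n => ‖B ^ n‖ / (r : ℝ) ^ n) (fun i _ => by positivity)
      (Finset.mem_range.2 (not_le.1 hn))
    linarith

end Flow

/-! ### Closed subspaces invariant under the group -/

section Subspace

variable {H : Type*} [NormedAddCommGroup H] [InnerProductSpace ℂ H] [CompleteSpace H]

theorem hasDerivAt_flow_apply (B : H →L[ℂ] H) (x : H) (t : ℝ) :
    HasDerivAt (fun t => flow B t x) (-B (flow B t x)) t := by
  have := (ContinuousLinearMap.apply ℂ H x).restrictScalars ℝ |>.hasFDerivAt.comp_hasDerivAt t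
    (hasDerivAt_flow B t)
  exact this.congr_deriv (by simp)

theorem continuous_flow_apply (B : H →L[ℂ] H) (x : H) : Continuous fun t => flow B t x :=
  continuous_iff_continuousAt.2 fun t => (hasDerivAt_flow_apply B x t).continuousAt

theorem flow_neg_apply_flow (B : H →L[ℂ] H) (t : ℝ) (x : H) : flow B (-t) (flow B t x) = x :=
  congrArg (fun T : H →L[ℂ] H => T x) (flow_neg_mul_flow B t)

theorem flow_apply_flow_neg (B : H →L[ℂ] H) (t : ℝ) (x : H) : flow B t (flow B (-t) x) = x :=
  congrArg (fun T : H →L[ℂ] H => T x) (flow_mul_flow_neg B t)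

theorem flow_mem_of_generator_mem {B : H →L[ℂ] H} {T : Submodule ℂ H} (hT : IsClosed (T : Set H))
    (h : ∀ x ∈ T, B x ∈ T) (t : ℝ) {x : H} (hx : x ∈ T) : flow B t x ∈ T := by
  have h1 := (ContinuousLinearMap.apply ℂ H x).hasSum (hasSum_flow B t)
  have h2 : ∀ n : ℕ, (((t : ℂ) • (-B)) ^ n) x ∈ T := fun n => by
    induction n with
    | zero => simpa using hx
    | succ n ih =>
      rw [pow_succ']
      exact T.smul_mem _ (T.neg_mem (h _ ih))
  exact hT.mem_of_tendsto h1 (Filter.Eventually.of_forall fun s =>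
    T.sum_mem fun n _ => T.smul_mem _ (h2 n))

/-- `-B x` is the right derivative of the orbit at `0`, a limit of difference quotients lying in
`T`. -/
theorem generator_mem_of_flow_mem {B : H →L[ℂ] H} {T : Submodule ℂ H} (hT : IsClosed (T : Set H))
    (h : ∀ t : ℝ, 0 ≤ t → ∀ x ∈ T, flow B t x ∈ T) {x : H} (hx : x ∈ T) : B x ∈ T := by
  have h1 := (hasDerivAt_flow_apply B x 0).tendsto_slope.mono_left
    (nhdsWithin_mono (0 : ℝ) (fun t (ht : t ∈ Ioi 0) => (ne_of_gt ht : t ≠ 0)))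
  have h2 : -B (flow B 0 x) ∈ T := by
    refine hT.mem_of_tendsto h1 ?_
    filter_upwards [self_mem_nhdsWithin] with t ht
    rw [slope_def_module, flow_zero]
    exact (T.restrictScalars ℝ).smul_mem _ (T.sub_mem (h t (le_of_lt ht) x hx) hx)
  simpa [flow_zero] using T.neg_mem h2

/-- Passing through the generator and then the exponential series turns forward invariance into
invariance for negative times. This permits reversing time on the unstable subspace. -/
theorem flow_mem_of_flow_mem_of_nonneg {B : H →L[ℂ] H} {T : Submodule ℂ H}
    (hT : IsClosed (T : Set H)) (h : ∀ t : ℝ, 0 ≤ t → ∀ x ∈ T, flow B t x ∈ T) (t : ℝ) {x : H}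
    (hx : x ∈ T) : flow B t x ∈ T :=
  flow_mem_of_generator_mem hT (fun _ hy => generator_mem_of_flow_mem hT h hy) t hx

end Subspace

end FlowGroup

/-! ### Fourier-Laplace transforms of causal orbits -/

section Laplace

theorem memLp_one_two_of_norm_le_exp {F : Type*} [NormedAddCommGroup F] {g : ℝ → F}
    (hg : AEStronglyMeasurable g) {K b : ℝ}
    (hb : 0 < b) (h0 : ∀ t < 0, g t = 0) (h : ∀ t, 0 ≤ t → ‖g t‖ ≤ K * Real.exp (-b * t)) :
    Integrable g ∧ MemLp g 2 := by
  have hint : ∀ c : ℝ, 0 < c → Integrable ((Ici (0 : ℝ)).indicator fun t => Real.exp (-c * t)) :=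
    fun c hc => (integrable_indicator_iff measurableSet_Ici).2
      ((integrableOn_Ici_iff_integrableOn_Ioi).2 (exp_neg_integrableOn_Ioi 0 hc))
  constructor
  · refine ((hint b hb).const_mul K).mono' hg (Filter.Eventually.of_forall fun t => ?_)
    by_cases ht : 0 ≤ t
    · simpa [indicator, ht] using h t ht
    · simp [indicator, ht, h0 t (not_le.1 ht)]
  · rw [memLp_two_iff_integrable_sq_norm hg]
    refine ((hint (2 * b) (by positivity)).const_mul (K ^ 2)).mono' (by fun_prop)
      (Filter.Eventually.of_forall fun t => ?_)
    rw [Real.norm_of_nonneg (by positivity)]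
    by_cases ht : 0 ≤ t
    · simp only [indicator, mem_Ici, ht, if_true]
      calc ‖g t‖ ^ 2 ≤ (K * Real.exp (-b * t)) ^ 2 := by gcongr; exact h t ht
        _ = _ := by rw [mul_pow, ← Real.exp_nat_mul]; congr 2; push_cast; ring
    · simp [indicator, ht, h0 t (not_le.1 ht)]

variable {H : Type*} [NormedAddCommGroup H] [InnerProductSpace ℂ H] [CompleteSpace H]

/-- On `L¹ ∩ L²` the unitary Fourier transform is given by the integral formula. -/
theorem fourier_toLp_ae_eq {f : ℝ → H} (h1 : Integrable f) (h2 : MemLp f 2) :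
    (𝓕 (h2.toLp f) : Lp H 2 (volume : Measure ℝ)) =ᵐ[volume] 𝓕 f := by
  refine ae_eq_of_integral_contDiff_smul_eq ((Lp.memLp _).locallyIntegrable one_le_two) ?_ ?_
  · exact (VectorFourier.fourierIntegral_continuous (L := innerₗ ℝ) Real.continuous_fourierChar
      continuous_inner h1).locallyIntegrable
  -- Against a test function both transforms move onto the test function: on `L²` through tempered
  -- distributions, on `L¹` by Fubini.
  intro g hg hgc
  have hc : HasCompactSupport (Complex.ofRealCLM ∘ g) := hgc.comp_left rfl
  have hs : ContDiff ℝ (⊤ : ℕ∞) (Complex.ofRealCLM ∘ g) := by fun_prop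
  set G := hc.toSchwartzMap hs with hG
  have hGg : ∀ x, G x = (g x : ℂ) := fun x => rfl
  have key := congrArg (fun T => T G) (Lp.fourier_toTemperedDistribution_eq (h2.toLp f))
  simp only [TemperedDistribution.fourier_apply, Lp.toTemperedDistribution_apply] at key
  calc ∫ x, g x • (𝓕 (h2.toLp f) : Lp H 2 (volume : Measure ℝ)) x
      = ∫ x, G x • (𝓕 (h2.toLp f) : Lp H 2 (volume : Measure ℝ)) x := by
        simp only [hGg, Complex.coe_smul]
    _ = ∫ x, (𝓕 G) x • (h2.toLp f : Lp H 2 (volume : Measure ℝ)) x := key.symm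
    _ = ∫ x, (𝓕 G) x • f x := integral_congr_ae (by
        filter_upwards [h2.coeFn_toLp] with x hx
        rw [hx])
    _ = ∫ x, G x • 𝓕 f x := by
        simpa using! VectorFourier.integral_fourierIntegral_smul_eq_flip (L := innerₗ ℝ)
          Real.continuous_fourierChar continuous_inner G.integrable h1
    _ = ∫ x, g x • 𝓕 f x := by simp only [hGg, Complex.coe_smul]

theorem quasiMeasurePreserving_div_two_pi :
    Measure.QuasiMeasurePreserving (fun t : ℝ => t / (2 * Real.pi)) volume volume := by
  refine ⟨by fun_prop, ?_⟩
  simp only [div_eq_mul_inv]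
  rw [Real.map_volume_mul_right (inv_ne_zero (by positivity))]
  exact Measure.smul_absolutelyContinuous

/-- When `exp(-ρ ·) f` is integrable, the Fourier-Laplace transform is the integral formula. -/
theorem fourierLaplace_ae_eq_of_integrable (ρ : ℝ) (f : ℝ → H) (hf : MemWeightedL2 ρ f)
    (h1 : Integrable fun t : ℝ => Real.exp (-ρ * t) • f t) :
    fourierLaplace ρ f hf =ᵐ[volume] fun t : ℝ => (Real.sqrt (2 * Real.pi))⁻¹ •
      ∫ s : ℝ, Complex.exp (-((t : ℂ) * Complex.I + (ρ : ℂ)) * (s : ℂ)) • f s := by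
  filter_upwards [quasiMeasurePreserving_div_two_pi.ae_eq_comp (fourier_toLp_ae_eq h1 hf)]
    with t ht
  simp only [Function.comp] at ht
  unfold fourierLaplace
  rw [ht, Real.fourier_real_eq_integral_exp_smul]
  congr 1
  refine integral_congr_ae (Filter.Eventually.of_forall fun s => ?_)
  simp only
  rw [← Complex.coe_smul, smul_smul, Complex.ofReal_exp, ← Complex.exp_add]
  congr 2
  push_cast
  have : (Real.pi : ℂ) ≠ 0 := by exact_mod_cast Real.pi_ne_zero
  field_simp
  ring

/-- Plancherel's theorem, after undoing the dilation by `2π`, which preserves null sets. -/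
theorem fourierLaplace_injective {ρ : ℝ} {f g : ℝ → H} (hf : MemWeightedL2 ρ f)
    (hg : MemWeightedL2 ρ g) (h : fourierLaplace ρ f hf =ᵐ[volume] fourierLaplace ρ g hg) :
    f =ᵐ[volume] g := by
  have hq : Measure.QuasiMeasurePreserving (fun t : ℝ => t * (2 * Real.pi)) volume volume := by
    refine ⟨by fun_prop, ?_⟩
    rw [Real.map_volume_mul_right (by positivity)]
    exact Measure.smul_absolutelyContinuous
  have h1 : (𝓕 (MemLp.toLp _ hf) : Lp H 2 (volume : Measure ℝ)) = 𝓕 (MemLp.toLp _ hg) := by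
    apply Lp.ext
    filter_upwards [hq.ae_eq_comp h] with t ht
    simp only [Function.comp, fourierLaplace] at ht
    rw [mul_div_cancel_right₀ t (by positivity)] at ht
    exact smul_right_injective H (inv_ne_zero (by positivity : Real.sqrt (2 * Real.pi) ≠ 0)) ht
  have h2 := (Lp.fourierTransformₗᵢ ℝ H).injective h1
  filter_upwards [(MemLp.toLp_eq_toLp_iff hf hg).1 h2] with t ht
  exact smul_right_injective H (Real.exp_ne_zero _) ht

/-- The causal solution `t ↦ exp(-tB) x` for `t ≥ 0`, extended by zero. -/
def causalFlow (B : H →L[ℂ] H) (x : H) : ℝ → H := (Ici (0 : ℝ)).indicator fun t => flow B t x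

theorem causalFlow_of_nonneg (B : H →L[ℂ] H) (x : H) {t : ℝ} (ht : 0 ≤ t) :
    causalFlow B x t = flow B t x := indicator_of_mem ht _

theorem causalFlow_of_neg (B : H →L[ℂ] H) (x : H) {t : ℝ} (ht : t < 0) :
    causalFlow B x t = 0 := indicator_of_notMem (not_le.2 ht) _

theorem stronglyMeasurable_causalFlow (B : H →L[ℂ] H) (x : H) :
    StronglyMeasurable (causalFlow B x) :=
  (continuous_flow_apply B x).stronglyMeasurable.indicator measurableSet_Ici

theorem continuousOn_causalFlow (B : H →L[ℂ] H) (x : H) :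
    ContinuousOn (causalFlow B x) (Ici 0) :=
  (continuous_flow_apply B x).continuousOn.congr fun _ ht => causalFlow_of_nonneg B x ht

theorem causalFlow_weighted {B : H →L[ℂ] H} {C r ρ : ℝ} (hr : r < ρ)
    (hC : ∀ n, ‖B ^ n‖ ≤ C * r ^ n) (x : H) :
    Integrable (fun t : ℝ => Real.exp (-ρ * t) • causalFlow B x t) ∧
      MemWeightedL2 ρ (causalFlow B x) := by
  refine memLp_one_two_of_norm_le_exp (K := C * ‖x‖) (b := ρ - r) ?_ (sub_pos.2 hr) ?_ ?_
  · exact ((by fun_prop : Continuous fun t : ℝ => Real.exp (-ρ * t)).stronglyMeasurable.smul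
      (stronglyMeasurable_causalFlow B x)).aestronglyMeasurable
  · intro t ht
    simp [causalFlow_of_neg B x ht]
  · intro t ht
    rw [causalFlow_of_nonneg B x ht, norm_smul, Real.norm_of_nonneg (Real.exp_pos _).le]
    have h1 := norm_flow_le_of_norm_pow_le hC t
    rw [abs_of_nonneg ht] at h1
    calc Real.exp (-ρ * t) * ‖flow B t x‖
        ≤ Real.exp (-ρ * t) * (C * Real.exp (r * t) * ‖x‖) := by
          gcongr
          exact ((flow B t).le_opNorm x).trans (by gcongr)
      _ = C * ‖x‖ * (Real.exp (-ρ * t) * Real.exp (r * t)) := by ring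
      _ = _ := by rw [← Real.exp_add]; congr 2; ring

/-- Applying `z + B` to `exp(-zs) exp(-sB) x` yields the derivative of its negative, so the integral
over `[0, ∞)` telescopes to the value `x` at `0`; the contribution at infinity vanishes because `r <
Re z`. -/
theorem laplace_causalFlow {B : H →L[ℂ] H} {C r : ℝ} {z : ℂ} (hr : r < z.re)
    (hC : ∀ n, ‖B ^ n‖ ≤ C * r ^ n) (x : H) :
    (z • (1 : H →L[ℂ] H) + B) (∫ s : ℝ, Complex.exp (-z * s) • causalFlow B x s) = x := by
  set f : ℝ → H := fun s => Complex.exp (-z * s) • flow B s x with hf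
  have hnorm : ∀ s : ℝ, ‖Complex.exp (-z * s)‖ = Real.exp (-z.re * s) := fun s => by
    rw [Complex.norm_exp]; simp
  have h0 : ∀ s : ℝ, Complex.exp (-z * s) • causalFlow B x s = (Ici (0 : ℝ)).indicator f s :=
      fun s => by
    by_cases hs : 0 ≤ s
    · rw [causalFlow_of_nonneg B x hs, indicator_of_mem (mem_Ici.2 hs)]
    · rw [causalFlow_of_neg B x (not_le.1 hs), indicator_of_notMem (by simpa using hs), smul_zero]
  have hcont : Continuous f := by
    have := continuous_flow_apply B x
    fun_prop
  have hint : Integrable ((Ici (0 : ℝ)).indicator f) := by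
    refine (causalFlow_weighted hr hC x).1.mono
      (hcont.aestronglyMeasurable.indicator measurableSet_Ici)
      (Filter.Eventually.of_forall fun s => ?_)
    rw [← h0, norm_smul, norm_smul, hnorm, Real.norm_of_nonneg (Real.exp_pos _).le]
  have hint' : IntegrableOn f (Ioi 0) :=
    ((integrable_indicator_iff measurableSet_Ici).1 hint).mono_set Ioi_subset_Ici_self
  simp only [h0]
  rw [integral_indicator measurableSet_Ici, integral_Ici_eq_integral_Ioi,
    ← ContinuousLinearMap.integral_comp_comm _ hint']
  have hder : ∀ s ∈ Ici (0 : ℝ), HasDerivAt (fun s => -f s)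
      ((z • (1 : H →L[ℂ] H) + B) (f s)) s := fun s _ => by
    have he : HasDerivAt (fun s : ℝ => Complex.exp (-z * s)) (Complex.exp (-z * s) * -z) s := by
      have : HasDerivAt (fun w : ℂ => Complex.exp (-z * w)) (Complex.exp (-z * s) * -z) (s : ℂ) := by
        simpa using ((hasDerivAt_id (s : ℂ)).const_mul (-z)).cexp
      exact this.comp_ofReal
    refine ((he.smul (hasDerivAt_flow_apply B x s)).neg).congr_deriv ?_
    simp only [hf, add_apply, smul_apply, one_apply_eq_self, map_smul, smul_neg, mul_neg, neg_smul,
      smul_add, smul_smul]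
    abel
  have hlim : Filter.Tendsto (fun s => -f s) Filter.atTop (nhds 0) := by
    have hb : Filter.Tendsto (fun s : ℝ => (C * ‖x‖) * Real.exp (-((z.re - r) * s)))
        Filter.atTop (nhds 0) := by
      rw [← mul_zero (C * ‖x‖)]
      refine Filter.Tendsto.const_mul _ (Real.tendsto_exp_neg_atTop_nhds_zero.comp ?_)
      exact Filter.tendsto_id.const_mul_atTop (sub_pos.2 hr)
    refine squeeze_zero_norm' ?_ hb
    filter_upwards [Filter.eventually_ge_atTop 0] with s hs
    have h1 := norm_flow_le_of_norm_pow_le hC s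
    rw [abs_of_nonneg hs] at h1
    rw [norm_neg, norm_smul, hnorm]
    calc Real.exp (-z.re * s) * ‖flow B s x‖
        ≤ Real.exp (-z.re * s) * (C * Real.exp (r * s) * ‖x‖) := by
          gcongr
          exact ((flow B s).le_opNorm x).trans (by gcongr)
      _ = C * ‖x‖ * (Real.exp (-z.re * s) * Real.exp (r * s)) := by ring
      _ = _ := by rw [← Real.exp_add]; congr 2; ring
  rw [integral_Ioi_of_hasDerivAt_of_tendsto' hder (ContinuousLinearMap.integrable_comp _ hint') hlim]
  simp [hf, flow_zero]

end Laplace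

/-! ### Identification of mild and strong solutions with orbits -/

section Solutions

variable {H : Type*} [NormedAddCommGroup H] [InnerProductSpace ℂ H]

namespace PencilSplitting

variable {M₀ M₁ : H →L[ℂ] H} (s : PencilSplitting M₀ M₁)

theorem isUnit_resolvent_of_isLargeRadius {ρ : ℝ} (h : IsLargeRadius M₀ M₁ ρ) (z : ℂ)
    (hz : ρ ≤ ‖z‖) : IsUnit (z • (1 : H →L[ℂ] H) + s.B) := by
  obtain ⟨hρ, hres, -⟩ := h
  have hu := (mem_pencilResolventSet_iff M₀ M₁ z).1 (hres z (by simpa using hz))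
  obtain ⟨h1, h2⟩ := s.resolvent_mul z (norm_pos_iff.1 (hρ.trans_le hz))
    (Ring.inverse_mul_cancel _ hu) (Ring.mul_inverse_cancel _ hu)
  exact ⟨⟨_, _, h2, h1⟩, rfl⟩

theorem E_apply_E (x : H) : s.E (s.E x) = s.E x :=
  congrArg (fun T : H →L[ℂ] H => T x) s.E_mul_E

theorem mem_initialValues_iff {x : H} : x ∈ initialValues M₀ M₁ ↔ s.E x = x := by
  constructor
  · rintro ⟨y, hy⟩
    have h1 : s.D (M₀ y) = 0 := congrArg (fun T : H →L[ℂ] H => T y) s.D_mul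
    have h2 : M₀ y = M₁ x := hy
    rw [h2] at h1
    simp [E, h1]
  · intro hx
    refine ⟨s.B x, ?_⟩
    have h1 : M₀ (s.B x) = M₁ (s.E x) := congrArg (fun T : H →L[ℂ] H => T x) s.M₀_mul_B
    rw [hx] at h1
    exact h1

theorem isClosed_initialValues (s : PencilSplitting M₀ M₁) :
    IsClosed (initialValues M₀ M₁ : Set H) := by
  have : (initialValues M₀ M₁ : Set H) = {x | s.E x = x} := by
    ext x; exact s.mem_initialValues_iff
  rw [this]
  exact isClosed_eq s.E.continuous continuous_id

variable [CompleteSpace H]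

/-- For `|z| ≥ ‖B‖ + 1` the operator `z + B` has an inverse of norm at most `1`, and the formula
`inverse` carries this bound to the pencil. The half plane of regularity thereby improves to the
exterior of a ball. -/
theorem exists_isLargeRadius (s : PencilSplitting M₀ M₁) : ∃ ρ, IsLargeRadius M₀ M₁ ρ := by
  have hball : ∀ z : ℂ, z ∉ Metric.ball (0 : ℂ) (‖s.B‖ + 1) → ‖s.B‖ + 1 ≤ ‖z‖ := fun z hz => by
    simpa using hz
  have hinv : ∀ z : ℂ, ‖s.B‖ + 1 ≤ ‖z‖ →
      ∃ r, (z • (1 : H →L[ℂ] H) + s.B) * r = 1 ∧ r * (z • (1 : H →L[ℂ] H) + s.B) = 1 := by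
    intro z hz
    have hu : IsUnit (z • (1 : H →L[ℂ] H) + s.B) := by
      by_contra hcon
      have hmem : z ∈ spectrum ℂ (-s.B) := by
        rwa [spectrum.mem_iff, sub_neg_eq_add, Algebra.algebraMap_eq_smul_one]
      have h1 := spectrum.norm_le_norm_mul_of_mem hmem
      have h2 : ‖(1 : H →L[ℂ] H)‖ ≤ 1 := ContinuousLinearMap.norm_id_le
      rw [norm_neg] at h1
      nlinarith [norm_nonneg s.B]
    obtain ⟨v, hv⟩ := hu
    exact ⟨↑v⁻¹, by rw [← hv, v.mul_inv], by rw [← hv, v.inv_mul]⟩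
  have hres : ∀ z : ℂ, ‖s.B‖ + 1 ≤ ‖z‖ → ∀ r, (z • (1 : H →L[ℂ] H) + s.B) * r = 1 →
      ‖r‖ ≤ 1 := by
    intro z hz r hr
    refine r.opNorm_le_bound zero_le_one fun x => ?_
    have h1 : z • r x = x - s.B (r x) := by
      have := congrArg (fun T : H →L[ℂ] H => T x) hr
      simp only [mul_apply_eq_comp, add_apply, smul_apply, one_apply_eq_self] at this
      rw [eq_sub_iff_add_eq]; exact this
    have h2 : ‖z‖ * ‖r x‖ ≤ ‖x‖ + ‖s.B‖ * ‖r x‖ := by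
      rw [← norm_smul, h1]
      exact (norm_sub_le _ _).trans (by gcongr; exact s.B.le_opNorm _)
    nlinarith [norm_nonneg (r x)]
  refine ⟨‖s.B‖ + 1, by positivity, fun z hz => ?_,
    ‖s.D‖ + ‖s.E‖ * 1 * ‖s.J‖ * ‖1 - M₁ * s.D‖, fun z hz => ?_⟩
  · obtain ⟨r, h1, h2⟩ := hinv z (hball z hz)
    rw [mem_pencilResolventSet_iff]
    exact ⟨⟨_, _, s.pencil_mul_inverse z h1, s.inverse_mul_pencil z h1 h2⟩, rfl⟩
  · obtain ⟨r, h1, h2⟩ := hinv z (hball z hz)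
    have h3 : pencilInv M₀ M₁ z = s.inverse r := by
      let v : (H →L[ℂ] H)ˣ :=
        ⟨pencil M₀ M₁ z, _, s.pencil_mul_inverse z h1, s.inverse_mul_pencil z h1 h2⟩
      exact Ring.inverse_unit v
    rw [h3, inverse]
    refine (norm_add_le _ _).trans ?_
    gcongr
    refine (norm_mul_le _ _).trans ?_
    gcongr
    refine (norm_mul_le _ _).trans ?_
    gcongr
    refine (norm_mul_le _ _).trans ?_
    gcongr
    exact hres z (hball z hz) r h1

theorem E_commute_flow (t : ℝ) : Commute s.E (flow s.B t) :=
  flow_commute (show s.E * s.B = s.B * s.E by rw [s.E_mul_B, s.B_mul_E]) t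

theorem E_flow (t : ℝ) (x : H) : s.E (flow s.B t x) = flow s.B t (s.E x) :=
  congrArg (fun T : H →L[ℂ] H => T x) (s.E_commute_flow t).eq

/-- The Laplace transform `Y` of the orbit solves `(z + B) Y = E x` and lies in the range of `E`, so
`pencil_mul_E` gives `𝓜(z) Y = M₀ E x = M₀ x`. Its validity for every large radius makes `S(𝓜)x`
independent of `ρ`. -/
theorem fourierLaplace_causalFlow {ρ : ℝ} (h : IsLargeRadius M₀ M₁ ρ) (x : H) :
    ∃ hw : MemWeightedL2 ρ (causalFlow s.B (s.E x)),
      fourierLaplace ρ (causalFlow s.B (s.E x)) hw =ᵐ[volume] fun t : ℝ =>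
        (Real.sqrt (2 * Real.pi))⁻¹ •
          pencilInv M₀ M₁ ((t : ℂ) * Complex.I + (ρ : ℂ)) (M₀ x) := by
  obtain ⟨r, hr, C, -, hC⟩ := exists_norm_pow_le h.1 (s.isUnit_resolvent_of_isLargeRadius h)
  obtain ⟨hw1, hw2⟩ := causalFlow_weighted hr hC (s.E x)
  refine ⟨hw2, (fourierLaplace_ae_eq_of_integrable ρ _ hw2 hw1).trans
    (Filter.Eventually.of_forall fun t => ?_)⟩
  simp only
  congr 1
  set z : ℂ := (t : ℂ) * Complex.I + (ρ : ℂ) with hz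
  have hzre : z.re = ρ := by simp [hz]
  set Y := ∫ u : ℝ, Complex.exp (-z * u) • causalFlow s.B (s.E x) u with hY
  have h1 : (z • (1 : H →L[ℂ] H) + s.B) Y = s.E x := laplace_causalFlow (by rwa [hzre]) hC (s.E x)
  have h2 : s.E Y = Y := by
    obtain ⟨v, hv⟩ := s.isUnit_resolvent_of_isLargeRadius h z
      (by rw [← hzre]; exact Complex.re_le_norm z)
    have hinj : ∀ y, (z • (1 : H →L[ℂ] H) + s.B) y = 0 → y = 0 := fun y hy => by
      have := congrArg (fun T : H →L[ℂ] H => T y) v.inv_mul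
      simp only [mul_apply_eq_comp, hv, hy, map_zero, one_apply_eq_self] at this
      exact this.symm
    have hc : (z • (1 : H →L[ℂ] H) + s.B) (s.E Y) = s.E ((z • (1 : H →L[ℂ] H) + s.B) Y) := by
      have e1 : s.B (s.E Y) = s.B Y := congrArg (fun T : H →L[ℂ] H => T Y) s.B_mul_E
      have e2 : s.E (s.B Y) = s.B Y := congrArg (fun T : H →L[ℂ] H => T Y) s.E_mul_B
      simp [e1, e2]
    rw [← sub_eq_zero]
    apply hinj
    rw [map_sub, hc, h1, s.E_apply_E, sub_self]
  have h3 : pencil M₀ M₁ z Y = M₀ x := by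
    calc pencil M₀ M₁ z Y = ((z • M₀ + M₁) * s.E) Y := by
          rw [mul_apply_eq_comp, h2, pencil]
      _ = M₀ ((z • (1 : H →L[ℂ] H) + s.B) Y) := by rw [s.pencil_mul_E]; rfl
      _ = (M₀ * s.E) x := by rw [h1]; rfl
      _ = M₀ x := by rw [s.M₀_mul_E]
  have hu : IsUnit (pencil M₀ M₁ z) := (mem_pencilResolventSet_iff M₀ M₁ z).1
    (h.2.1 z (by simpa [← hzre] using Complex.re_le_norm z))
  rw [← h3]
  exact (congrArg (fun T : H →L[ℂ] H => T Y) (Ring.inverse_mul_cancel _ hu)).symm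

theorem representsSolution_causalFlow (x : H) :
    RepresentsSolution M₀ M₁ x (causalFlow s.B (s.E x)) := by
  obtain ⟨ρ, hρ⟩ := s.exists_isLargeRadius
  exact ⟨ρ, hρ, s.fourierLaplace_causalFlow hρ x⟩

theorem ae_eq_causalFlow {x : H} {u : ℝ → H} (h : RepresentsSolution M₀ M₁ x u) :
    u =ᵐ[volume] causalFlow s.B (s.E x) := by
  obtain ⟨ρ, hρ, hu, hL⟩ := h
  obtain ⟨hw, hL'⟩ := s.fourierLaplace_causalFlow hρ x
  exact fourierLaplace_injective hu hw (hL.trans hL'.symm)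

theorem eq_flow_of_representsSolution {x : H} {u : ℝ → H} (h : RepresentsSolution M₀ M₁ x u)
    (hc : ContinuousOn u (Ici 0)) {t : ℝ} (ht : 0 ≤ t) : u t = flow s.B t (s.E x) := by
  rw [← causalFlow_of_nonneg _ _ ht]
  refine Measure.eqOn_of_ae_eq (μ := volume) (ae_restrict_of_ae (s.ae_eq_causalFlow h)) hc
    (continuousOn_causalFlow _ _) ?_ (mem_Ici.2 ht)
  rw [interior_Ici, closure_Ioi]

theorem flow_isStrongSolution {x : H} (hx : s.E x = x) :
    IsStrongSolution M₀ M₁ x (fun t => flow s.B t x) := by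
  refine ⟨(continuous_flow_apply _ _).continuousOn, ContDiff.contDiffOn ?_, fun t _ => ?_,
    by simp [flow_zero]⟩
  · rw [contDiff_one_iff_deriv]
    refine ⟨fun t => (hasDerivAt_flow_apply s.B x t).differentiableAt, ?_⟩
    rw [funext fun t => (hasDerivAt_flow_apply s.B x t).deriv]
    exact (s.B.continuous.comp (continuous_flow_apply s.B x)).neg
  · rw [(hasDerivAt_flow_apply s.B x t).deriv, map_neg]
    have h1 : M₀ (s.B (flow s.B t x)) = M₁ (s.E (flow s.B t x)) :=
      congrArg (fun T : H →L[ℂ] H => T (flow s.B t x)) s.M₀_mul_B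
    rw [h1, s.E_flow, hx, neg_add_cancel]

/-- The equation puts `M₁ u(t)` in `R(M₀)`, so `u`, and with it `u'`, stays in the range of `E`.
Applying `E J` to the equation then leaves `u' = -B u`, and `exp(tB) u(t)` is constant on `(0, ∞)`;
continuity at `0` identifies the constant. -/
theorem eq_flow_of_isStrongSolution {x : H} {u : ℝ → H} (h : IsStrongSolution M₀ M₁ x u)
    {t : ℝ} (ht : 0 ≤ t) : u t = flow s.B t x := by
  obtain ⟨hc, hd, heq, h0⟩ := h
  have hdiff : ∀ t, 0 < t → DifferentiableAt ℝ u t := fun t ht =>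
    (hd.contDiffAt (Ioi_mem_nhds ht)).differentiableAt one_ne_zero
  have hE : ∀ t, 0 < t → s.E (u t) = u t := fun t ht => s.mem_initialValues_iff.1
    ⟨-deriv u t, by
      have := heq t ht
      simpa using (eq_neg_of_add_eq_zero_right this).symm⟩
  have hder : ∀ t, 0 < t → HasDerivAt u (-s.B (u t)) t := fun t ht => by
    have h1 : HasDerivAt (fun t => s.E (u t)) (s.E (deriv u t)) t :=
      (s.E.restrictScalars ℝ).hasFDerivAt.comp_hasDerivAt t (hdiff t ht).hasDerivAt
    have h2 : s.E (deriv u t) = deriv u t := by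
      refine h1.unique ((hdiff t ht).hasDerivAt.congr_of_eventuallyEq ?_)
      filter_upwards [Ioi_mem_nhds ht] with r hr using hE r hr
    have h3 : s.E (s.J (M₀ (deriv u t))) = s.E (deriv u t) :=
      congrArg (fun T : H →L[ℂ] H => T (deriv u t)) s.E_mul_J_mul
    have h4 : s.B (u t) = s.E (s.J (M₁ (s.E (u t)))) := rfl
    have h5 := congrArg (fun y => s.E (s.J y)) (heq t ht)
    simp only [map_add, map_zero, h3, h2] at h5
    rw [hE t ht] at h4
    rw [h4, ← eq_neg_of_add_eq_zero_left h5]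
    exact (hdiff t ht).hasDerivAt
  set v : ℝ → H := fun t => flow (-s.B) t (u t) with hv
  have hvder : ∀ t, 0 < t → HasDerivAt v 0 t := fun t ht => by
    have h1 := ((isBoundedBilinearMap_apply (𝕜 := ℂ) (E := H) (F := H)).hasFDerivAt
      (flow (-s.B) t, u t)).restrictScalars ℝ |>.comp_hasDerivAt t
        ((hasDerivAt_flow (-s.B) t).prodMk (hder t ht))
    refine h1.congr_deriv ?_
    have h2 := congrArg (fun T : H →L[ℂ] H => T (u t))
      (flow_commute (Commute.neg_right (Commute.refl s.B)) t).eq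
    simp only [mul_apply_eq_comp] at h2
    simp [h2]
  have hvc : ContinuousOn v (Ici 0) := (continuous_flow (-s.B)).continuousOn.clm_apply hc
  have hconst : ∀ a, 0 < a → ∀ b, 0 < b → v a = v b := fun a ha b hb =>
    isOpen_Ioi.is_const_of_deriv_eq_zero isPreconnected_Ioi
      (fun t ht => (hvder t ht).differentiableAt.differentiableWithinAt)
      (fun t ht => (hvder t ht).deriv) ha hb
  have hv0 : v t = x := by
    have hv00 : v 0 = x := by simp [hv, flow_zero, h0]
    rcases ht.eq_or_lt with rfl | ht'
    · exact hv00
    have h1 : Filter.Tendsto v (nhdsWithin 0 (Ioi 0)) (nhds (v 0)) :=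
      (hvc 0 self_mem_Ici).mono_left (nhdsWithin_mono _ Ioi_subset_Ici_self)
    have h2 : Filter.Tendsto v (nhdsWithin 0 (Ioi 0)) (nhds (v t)) := by
      refine tendsto_const_nhds.congr' ?_
      filter_upwards [self_mem_nhdsWithin] with r hr using hconst t ht' r hr
    rw [tendsto_nhds_unique h2 h1, hv00]
  rw [← hv0, hv]
  simp only
  rw [flow_neg_left, flow_apply_flow_neg]

end PencilSplitting

end Solutions

/-! ### Transport and comparison of the two dichotomies -/

section Dichotomy

variable {H : Type*} [NormedAddCommGroup H] [InnerProductSpace ℂ H]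

theorem isClosed_map_of_leftInverse {S V W : Submodule ℂ H} (f g : H →L[ℂ] H)
    (hS : IsClosed (S : Set H)) (hW : IsClosed (W : Set H)) (hSV : S ≤ V)
    (hfV : ∀ x ∈ V, f x ∈ W) (hgf : ∀ x ∈ V, g (f x) = x) (hfg : ∀ y ∈ W, f (g y) = y) :
    IsClosed (S.map (f : H →ₗ[ℂ] H) : Set H) := by
  have : (S.map (f : H →ₗ[ℂ] H) : Set H) = (W : Set H) ∩ g ⁻¹' (S : Set H) := by
    ext y
    constructor
    · rintro ⟨x, hx, rfl⟩
      refine ⟨hfV x (hSV hx), ?_⟩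
      change g (f x) ∈ S
      rwa [hgf x (hSV hx)]
    · rintro ⟨hy, hgy⟩
      exact ⟨g y, hgy, hfg y hy⟩
  rw [this]
  exact hW.inter (hS.preimage g.continuous)

/-- Closed decompositions are transported by mutually inverse continuous linear maps. -/
theorem IsClosedDecomposition.map {S T V W : Submodule ℂ H} (h : IsClosedDecomposition S T V)
    (f g : H →L[ℂ] H) (hW : IsClosed (W : Set H))
    (hfV : ∀ x ∈ V, f x ∈ W) (hgW : ∀ y ∈ W, g y ∈ V)
    (hgf : ∀ x ∈ V, g (f x) = x) (hfg : ∀ y ∈ W, f (g y) = y) :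
    IsClosedDecomposition (S.map (f : H →ₗ[ℂ] H)) (T.map (f : H →ₗ[ℂ] H)) W := by
  obtain ⟨hS, hT, hinf, hsup⟩ := h
  have hSV : S ≤ V := hsup ▸ le_sup_left
  have hTV : T ≤ V := hsup ▸ le_sup_right
  refine ⟨isClosed_map_of_leftInverse f g hS hW hSV hfV hgf hfg,
    isClosed_map_of_leftInverse f g hT hW hTV hfV hgf hfg, ?_, ?_⟩
  · rw [Submodule.eq_bot_iff]
    rintro _ ⟨⟨x, hx, rfl⟩, ⟨y, hy, hxy⟩⟩
    have hxy' : f y = f x := hxy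
    have h1 : y = x := by rw [← hgf y (hTV hy), hxy', hgf x (hSV hx)]
    have h2 : x ∈ S ⊓ T := ⟨hx, h1 ▸ hy⟩
    rw [hinf, Submodule.mem_bot] at h2
    rw [h2, map_zero]
  · rw [← Submodule.map_sup, hsup]
    ext y
    constructor
    · rintro ⟨x, hx, rfl⟩
      exact hfV x hx
    · intro hy
      exact ⟨g y, hgW y hy, hfg y hy⟩

theorem kerPerp_isClosed (M₀ : H →L[ℂ] H) : IsClosed (kerPerp M₀ : Set H) :=
  Submodule.isClosed_orthogonal _

variable [CompleteSpace H]

/-- Square integrability of `exp(ρt) exp(-tB) x` implies its boundedness. -/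
theorem exists_norm_flow_le_of_memWeightedL2 {B : H →L[ℂ] H} {x : H} {ρ : ℝ} (hρ : 0 < ρ)
    (h : MemWeightedL2 (-ρ) (causalFlow B x)) :
    ∃ K, ∀ t, 0 ≤ t → Real.exp (ρ * t) * ‖flow B t x‖ ≤ K := by
  obtain ⟨C, hC0, hC⟩ := exists_norm_flow_le B
  -- A bound for the flow over times of modulus at most one. It controls the value at `t` by the
  -- values on `[t, t + 1]`, over which the square is then integrated.
  set L := C * Real.exp ‖B‖ with hL
  have hL0 : 0 ≤ L := by positivity
  set F : ℝ → ℝ := fun t => ‖Real.exp (-(-ρ) * t) • causalFlow B x t‖ ^ 2 with hF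
  have hFi : Integrable F := (memLp_two_iff_integrable_sq_norm h.1).1 h
  have hFt : ∀ t, 0 ≤ t → F t = (Real.exp (ρ * t) * ‖flow B t x‖) ^ 2 := fun t ht => by
    simp only [hF]
    rw [causalFlow_of_nonneg B x ht, norm_smul, Real.norm_of_nonneg (Real.exp_pos _).le, neg_neg]
  refine ⟨Real.sqrt (L ^ 2 * ∫ t, F t), fun t ht => Real.le_sqrt_of_sq_le ?_⟩
  have hstep : ∀ r ∈ Icc t (t + 1), (Real.exp (ρ * t) * ‖flow B t x‖) ^ 2 ≤ L ^ 2 * F r := by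
    intro r hr
    rw [hFt r (ht.trans hr.1), ← mul_pow]
    have h1 : flow B t x = flow B (t - r) (flow B r x) := by
      have := congrArg (fun T : H →L[ℂ] H => T x) (flow_add B (t - r) r)
      rw [sub_add_cancel] at this
      exact this
    have h2 : ‖flow B (t - r)‖ ≤ L := by
      refine (hC _).trans ?_
      rw [hL]
      gcongr
      refine mul_le_of_le_one_right (norm_nonneg _) ?_
      rw [abs_le]; constructor <;> linarith [hr.1, hr.2]
    have h3 : ‖flow B t x‖ ≤ L * ‖flow B r x‖ := by
      rw [h1]; exact ((flow B (t - r)).le_opNorm _).trans (by gcongr)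
    refine pow_le_pow_left₀ (by positivity) ?_ 2
    calc Real.exp (ρ * t) * ‖flow B t x‖ ≤ Real.exp (ρ * r) * (L * ‖flow B r x‖) := by
          gcongr; exact hr.1
      _ = _ := by ring
  have h1 : ∫ _ in Icc t (t + 1), (Real.exp (ρ * t) * ‖flow B t x‖) ^ 2 ≤
      ∫ r in Icc t (t + 1), L ^ 2 * F r :=
    setIntegral_mono_on (integrableOn_const (by simp)) (hFi.const_mul _).integrableOn
      measurableSet_Icc hstep
  have h2 : ∫ r in Icc t (t + 1), L ^ 2 * F r ≤ ∫ r, L ^ 2 * F r :=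
    setIntegral_le_integral (hFi.const_mul _)
      (Filter.Eventually.of_forall fun r => by simp only [hF, Pi.zero_apply]; positivity)
  simp only [integral_const_mul] at h1 h2
  simp only [integral_const, measureReal_restrict_apply_univ, Real.volume_real_Icc,
    add_sub_cancel_left, zero_le_one, max_eq_left, one_smul] at h1
  exact h1.trans h2

/-- Square integrability of all weighted orbits in a closed subspace implies uniform decay. -/
theorem exists_uniform_decay {B : H →L[ℂ] H} {S : Submodule ℂ H} (hS : IsClosed (S : Set H))
    {ρ : ℝ} (hρ : 0 < ρ) (h : ∀ x ∈ S, MemWeightedL2 (-ρ) (causalFlow B x)) :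
    ∃ C, 0 < C ∧ ∀ x ∈ S, ∀ t, 0 ≤ t → ‖flow B t x‖ ≤ C * Real.exp (-ρ * t) * ‖x‖ := by
  have : CompleteSpace S := hS.completeSpace_coe
  -- The orbitwise bounds say that the operators `exp(ρt) exp(-tB)`, `t ≥ 0`, are pointwise bounded
  -- on the Banach space `S`.
  obtain ⟨C, hC⟩ := banach_steinhaus
    (g := fun t : Ici (0 : ℝ) => (Real.exp (ρ * t) : ℂ) • (flow B t).comp S.subtypeL) (fun x => by
      obtain ⟨K, hK⟩ := exists_norm_flow_le_of_memWeightedL2 hρ (h x x.2)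
      refine ⟨K, fun t => ?_⟩
      have := hK t t.2
      rw [smul_apply, norm_smul, Complex.norm_real, Real.norm_of_nonneg (Real.exp_pos _).le]
      exact this)
  refine ⟨max C 1, by positivity, fun x hx t ht => ?_⟩
  have h1 := ((Real.exp (ρ * t) : ℂ) • (flow B t).comp S.subtypeL).le_of_opNorm_le
    (hC ⟨t, ht⟩) ⟨x, hx⟩
  rw [smul_apply, norm_smul, Complex.norm_real, Real.norm_of_nonneg (Real.exp_pos _).le] at h1
  have h2 : Real.exp (ρ * t) * ‖flow B t x‖ ≤ C * ‖x‖ := h1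
  have h3 : Real.exp (-ρ * t) * Real.exp (ρ * t) = 1 := by rw [← Real.exp_add]; simp
  calc ‖flow B t x‖ = Real.exp (-ρ * t) * (Real.exp (ρ * t) * ‖flow B t x‖) := by
        rw [← mul_assoc, h3, one_mul]
    _ ≤ Real.exp (-ρ * t) * (max C 1 * ‖x‖) := by
        refine mul_le_mul_of_nonneg_left (h2.trans ?_) (Real.exp_pos _).le
        gcongr
        exact le_max_left _ _
    _ = _ := by ring

theorem kerPerpProj_eq_self {M₀ : H →L[ℂ] H} {x : H} (hx : x ∈ kerPerp M₀) :
    kerPerpProj M₀ x = x :=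
  Submodule.starProjection_eq_self_iff (K := (LinearMap.ker (M₀ : H →ₗ[ℂ] H))ᗮ).2 hx

theorem kerPerpProj_mem (M₀ : H →L[ℂ] H) (x : H) : kerPerpProj M₀ x ∈ kerPerp M₀ :=
  Submodule.starProjection_apply_mem (LinearMap.ker (M₀ : H →ₗ[ℂ] H))ᗮ x

theorem norm_kerPerpProj_le (M₀ : H →L[ℂ] H) (x : H) : ‖kerPerpProj M₀ x‖ ≤ ‖x‖ :=
  Submodule.norm_starProjection_apply_le _ x

namespace PencilSplitting

variable {M₀ M₁ : H →L[ℂ] H} (s : PencilSplitting M₀ M₁)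

/-- With `E_kerPerpProj`, this makes the two projections inverse to each other between `IV` and
`N(M₀)^⊥`: both have kernel `N(M₀)`. -/
theorem kerPerpProj_E (hJ : s.J * M₀ = kerPerpProj M₀) (x : H) :
    kerPerpProj M₀ (s.E x) = kerPerpProj M₀ x := by
  rw [← hJ]; exact congrArg (fun T : H →L[ℂ] H => T x) s.J_mul_E

theorem E_kerPerpProj (hJ : s.J * M₀ = kerPerpProj M₀) (x : H) :
    s.E (kerPerpProj M₀ x) = s.E x := by
  rw [← hJ]; exact congrArg (fun T : H →L[ℂ] H => T x) s.E_mul_J_mul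

theorem decomposition_map_kerPerpProj (hJ : s.J * M₀ = kerPerpProj M₀) {S T : Submodule ℂ H}
    (h : IsClosedDecomposition S T (initialValues M₀ M₁)) :
    IsClosedDecomposition (S.map (kerPerpProj M₀ : H →ₗ[ℂ] H))
      (T.map (kerPerpProj M₀ : H →ₗ[ℂ] H)) (kerPerp M₀) := by
  refine h.map (kerPerpProj M₀) s.E (kerPerp_isClosed M₀) (fun x _ => kerPerpProj_mem M₀ x)
    (fun y _ => s.mem_initialValues_iff.2 (s.E_apply_E y)) (fun x hx => ?_) (fun y hy => ?_)
  · rw [s.E_kerPerpProj hJ, s.mem_initialValues_iff.1 hx]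
  · rw [s.kerPerpProj_E hJ, kerPerpProj_eq_self hy]

theorem decomposition_map_E (hJ : s.J * M₀ = kerPerpProj M₀) {S T : Submodule ℂ H}
    (h : IsClosedDecomposition S T (kerPerp M₀)) :
    IsClosedDecomposition (S.map (s.E : H →ₗ[ℂ] H)) (T.map (s.E : H →ₗ[ℂ] H))
      (initialValues M₀ M₁) := by
  refine h.map s.E (kerPerpProj M₀) s.isClosed_initialValues
    (fun y _ => s.mem_initialValues_iff.2 (s.E_apply_E y))
    (fun x _ => kerPerpProj_mem M₀ x) (fun y hy => ?_) (fun x hx => ?_)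
  · rw [s.kerPerpProj_E hJ, kerPerpProj_eq_self hy]
  · rw [s.E_kerPerpProj hJ, s.mem_initialValues_iff.1 hx]

/-- Uniformly decaying invariant subspaces of initial values project to mild solutions. -/
theorem exists_mild_of_decay (hJ : s.J * M₀ = kerPerpProj M₀) {S : Submodule ℂ H}
    (hE : ∀ x ∈ S, s.E x = x) (hinv : ∀ t, 0 ≤ t → ∀ x ∈ S, flow s.B t x ∈ S)
    {ρ C : ℝ} (hρ : 0 < ρ)
    (hdecay : ∀ x ∈ S, ∀ t, 0 ≤ t → ‖flow s.B t x‖ ≤ C * Real.exp (-ρ * t) * ‖x‖) {y : H}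
    (hy : y ∈ S.map (kerPerpProj M₀ : H →ₗ[ℂ] H)) :
    ∃ u : ℝ → H, RepresentsSolution M₀ M₁ y u ∧
      MemWeightedL2In (-(ρ / 2)) (S.map (kerPerpProj M₀ : H →ₗ[ℂ] H))
        (fun t => kerPerpProj M₀ (u t)) := by
  obtain ⟨x, hx, rfl⟩ := hy
  refine ⟨_, s.representsSolution_causalFlow _, ?_⟩
  have hEx : s.E (kerPerpProj M₀ x) = x := by rw [s.E_kerPerpProj hJ, hE x hx]
  change MemWeightedL2In _ _ (fun t => kerPerpProj M₀ (causalFlow s.B (s.E (kerPerpProj M₀ x)) t))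
  rw [hEx]
  constructor
  -- Half of the decay rate is spent on the weight, the other half on integrability.
  · refine (memLp_one_two_of_norm_le_exp (K := C * ‖x‖) ?_ (half_pos hρ) ?_ ?_).2
    · exact ((by fun_prop : Continuous fun t : ℝ => Real.exp (-(-(ρ / 2)) * t)).stronglyMeasurable.smul
        ((kerPerpProj M₀).continuous.comp_stronglyMeasurable
          (stronglyMeasurable_causalFlow s.B x))).aestronglyMeasurable
    · intro t ht
      simp [causalFlow_of_neg s.B x ht]
    · intro t ht
      simp only
      rw [causalFlow_of_nonneg s.B x ht, norm_smul, Real.norm_of_nonneg (Real.exp_pos _).le]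
      calc Real.exp (-(-(ρ / 2)) * t) * ‖kerPerpProj M₀ (flow s.B t x)‖
          ≤ Real.exp (-(-(ρ / 2)) * t) * (C * Real.exp (-ρ * t) * ‖x‖) := by
            gcongr
            exact (norm_kerPerpProj_le M₀ _).trans (hdecay x hx t ht)
        _ = C * ‖x‖ * (Real.exp (-(-(ρ / 2)) * t) * Real.exp (-ρ * t)) := by ring
        _ = _ := by rw [← Real.exp_add]; congr 2; ring
  · refine Filter.Eventually.of_forall fun t => ?_
    change kerPerpProj M₀ (causalFlow s.B x t) ∈ _
    rcases lt_or_ge t 0 with ht | ht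
    · rw [causalFlow_of_neg s.B x ht, map_zero]
      exact Submodule.zero_mem _
    · rw [causalFlow_of_nonneg s.B x ht]
      exact ⟨_, hinv t ht x hx, rfl⟩

/-- Mild decay on a closed subspace of `N(M₀)^⊥` lifts to invariance and uniform decay on the
corresponding subspace of initial values. -/
theorem invariant_and_decay_of_mild (hJ : s.J * M₀ = kerPerpProj M₀) {S : Submodule ℂ H}
    (hS : IsClosed (S : Set H)) (hSE : IsClosed (S.map (s.E : H →ₗ[ℂ] H) : Set H))
    {ρ : ℝ} (hρ : 0 < ρ)
    (h : ∀ y ∈ S, ∃ u : ℝ → H, RepresentsSolution M₀ M₁ y u ∧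
      MemWeightedL2In (-ρ) S (fun t => kerPerpProj M₀ (u t))) :
    (∀ t, 0 ≤ t → ∀ x ∈ S.map (s.E : H →ₗ[ℂ] H), flow s.B t x ∈ S.map (s.E : H →ₗ[ℂ] H)) ∧
      ∃ C, 0 < C ∧ ∀ x ∈ S.map (s.E : H →ₗ[ℂ] H), ∀ t, 0 ≤ t →
        ‖flow s.B t x‖ ≤ C * Real.exp (-ρ * t) * ‖x‖ := by
  have hEP : ∀ y t, s.E (kerPerpProj M₀ (causalFlow s.B (s.E y) t)) = causalFlow s.B (s.E y) t := by
    intro y t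
    rw [s.E_kerPerpProj hJ]
    rcases lt_or_ge t 0 with ht | ht
    · rw [causalFlow_of_neg _ _ ht, map_zero]
    · rw [causalFlow_of_nonneg _ _ ht, s.E_flow, s.E_apply_E]
  constructor
  · rintro t ht _ ⟨y, hy, rfl⟩
    change flow s.B t (s.E y) ∈ _
    rcases ht.eq_or_lt with rfl | ht'
    · rw [flow_zero]; exact ⟨y, hy, rfl⟩
    obtain ⟨u, hu, -, hmem⟩ := h y hy
    -- The mild condition gives membership in `S` only almost everywhere. The exceptional times form
    -- an open null set, as `S` is closed and the orbit continuous, hence there are none.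
    set U : Set ℝ := Ioi 0 ∩ (fun t => kerPerpProj M₀ (flow s.B t (s.E y))) ⁻¹' (S : Set H)ᶜ with hU
    have hUo : IsOpen U := isOpen_Ioi.inter (hS.isOpen_compl.preimage
      ((kerPerpProj M₀).continuous.comp (continuous_flow_apply _ _)))
    have hU0 : volume U = 0 := by
      refine measure_mono_null ?_ (hmem.and (s.ae_eq_causalFlow hu))
      rintro r ⟨hr0, hr⟩ ⟨h1, h2⟩
      simp only at h1
      rw [h2, causalFlow_of_nonneg _ _ (le_of_lt hr0)] at h1
      exact hr h1
    have hUe : U = ∅ := (hUo.measure_eq_zero_iff volume).1 hU0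
    have htU : t ∉ U := by rw [hUe]; exact notMem_empty t
    have hS' : kerPerpProj M₀ (flow s.B t (s.E y)) ∈ S := by
      by_contra hcon
      exact htU ⟨ht', hcon⟩
    refine ⟨_, hS', ?_⟩
    have := hEP y t
    rwa [causalFlow_of_nonneg _ _ ht] at this
  · refine exists_uniform_decay hSE hρ ?_
    rintro _ ⟨y, hy, rfl⟩
    change MemWeightedL2 (-ρ) (causalFlow s.B (s.E y))
    obtain ⟨u, hu, hL2, -⟩ := h y hy
    refine (s.E.comp_memLp' hL2).ae_eq ?_
    filter_upwards [s.ae_eq_causalFlow hu] with t ht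
    simp only [Function.comp]
    rw [ht, ← Complex.coe_smul, map_smul, hEP, Complex.coe_smul]

theorem flow_mem_of_isInvariant {S : Submodule ℂ H} (h : IsInvariant M₀ M₁ S) (t : ℝ) (ht : 0 ≤ t)
    (x : H) (hx : x ∈ S) : flow s.B t x ∈ S := by
  rcases ht.eq_or_lt with rfl | ht'
  · rwa [flow_zero]
  obtain ⟨u, hu, hmem⟩ := h x hx
  rw [← s.eq_flow_of_isStrongSolution hu ht]
  exact hmem t ht'

theorem isInvariant_of_flow_mem {S : Submodule ℂ H} (hE : ∀ x ∈ S, s.E x = x)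
    (h : ∀ t, 0 ≤ t → ∀ x ∈ S, flow s.B t x ∈ S) : IsInvariant M₀ M₁ S :=
  fun x hx => ⟨_, s.flow_isStrongSolution (hE x hx), fun t ht => h t ht.le x hx⟩

theorem isMildDichotomy_map (hJ : s.J * M₀ = kerPerpProj M₀) {S T : Submodule ℂ H}
    (h : IsStrongDichotomy M₀ M₁ S T) :
    IsMildDichotomy M₀ M₁ (S.map (kerPerpProj M₀ : H →ₗ[ℂ] H))
      (T.map (kerPerpProj M₀ : H →ₗ[ℂ] H)) := by
  obtain ⟨hdec, hSi, hTi, ρ, hρ, C, hC, c, hc, hS, hT⟩ := h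
  have hES : ∀ x ∈ S, s.E x = x := fun x hx =>
    s.mem_initialValues_iff.1 (hdec.2.2.2 ▸ Submodule.mem_sup_left hx)
  have hET : ∀ x ∈ T, s.E x = x := fun x hx =>
    s.mem_initialValues_iff.1 (hdec.2.2.2 ▸ Submodule.mem_sup_right hx)
  have hTflow : ∀ t, ∀ x ∈ T, flow s.B t x ∈ T := fun t x hx =>
    flow_mem_of_flow_mem_of_nonneg hdec.2.1 (s.flow_mem_of_isInvariant hTi) t hx
  refine ⟨s.decomposition_map_kerPerpProj hJ hdec, ρ / 2, half_pos hρ, fun y hy => ?_,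
    fun y hy => ?_⟩
  · refine s.exists_mild_of_decay hJ hES (s.flow_mem_of_isInvariant hSi) hρ (C := C) ?_ hy
    intro x hx t ht
    obtain ⟨u, hu, huc, hub⟩ := hS x hx
    have h1 := s.eq_flow_of_representsSolution hu huc ht
    rw [hES x hx] at h1
    rw [← h1]
    exact hub t ht
  -- The growth estimate started at `exp(tB) x`, which lies in `T` by invariance under the group,
  -- arrives at `x` after time `t`; this is decay of the flow of `𝓝` with constant `c⁻¹`.
  · refine s.neg.exists_mild_of_decay hJ (by rwa [neg_E]) ?_ hρ (C := c⁻¹) ?_ hy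
    · intro t _ x hx
      rw [neg_B, flow_neg_left]
      exact hTflow (-t) x hx
    · intro x hx t ht
      rw [neg_B, flow_neg_left]
      have hz := hTflow (-t) x hx
      obtain ⟨u, hu, huc, hub⟩ := hT _ hz
      have h1 := s.eq_flow_of_representsSolution hu huc ht
      rw [hET _ hz, flow_apply_flow_neg] at h1
      have h2 := hub t ht
      rw [h1] at h2
      have h3 : Real.exp (-ρ * t) * Real.exp (ρ * t) = 1 := by rw [← Real.exp_add]; simp
      calc ‖flow s.B (-t) x‖
          = c⁻¹ * Real.exp (-ρ * t) * (c * Real.exp (ρ * t) * ‖flow s.B (-t) x‖) := by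
            rw [← mul_assoc, mul_mul_mul_comm, inv_mul_cancel₀ hc.ne', h3]; ring
        _ ≤ _ := by gcongr

theorem isStrongDichotomy_map (hJ : s.J * M₀ = kerPerpProj M₀) {S T : Submodule ℂ H}
    (h : IsMildDichotomy M₀ M₁ S T) :
    IsStrongDichotomy M₀ M₁ (S.map (s.E : H →ₗ[ℂ] H)) (T.map (s.E : H →ₗ[ℂ] H)) := by
  obtain ⟨hdec, ρ, hρ, hS, hT⟩ := h
  have hdec' := s.decomposition_map_E hJ hdec
  have hE : ∀ V : Submodule ℂ H, ∀ x ∈ V.map (s.E : H →ₗ[ℂ] H), s.E x = x := by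
    rintro V _ ⟨y, -, rfl⟩
    exact s.E_apply_E y
  obtain ⟨hSi, C, hC, hCb⟩ := s.invariant_and_decay_of_mild hJ hdec.1 hdec'.1 hρ hS
  obtain ⟨hTi, C', hC', hCb'⟩ := s.neg.invariant_and_decay_of_mild hJ hdec.2.1
    (by rw [neg_E]; exact hdec'.2.1) hρ hT
  simp only [neg_E, neg_B] at hTi hCb'
  -- The mild condition on `T` concerns `𝓝` and yields invariance under the backward flow only;
  -- closedness extends it to the forward flow.
  have hTflow : ∀ t, 0 ≤ t → ∀ x ∈ T.map (s.E : H →ₗ[ℂ] H),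
      flow s.B t x ∈ T.map (s.E : H →ₗ[ℂ] H) := fun t _ x hx => by
    have h1 := flow_mem_of_flow_mem_of_nonneg hdec'.2.1 hTi (-t) hx
    rwa [flow_neg_left, neg_neg] at h1
  refine ⟨hdec', s.isInvariant_of_flow_mem (hE S) hSi, s.isInvariant_of_flow_mem (hE T) hTflow,
    ρ, hρ, C, hC, C'⁻¹, inv_pos.2 hC', fun x hx => ?_, fun x hx => ?_⟩
  · refine ⟨_, s.representsSolution_causalFlow x, continuousOn_causalFlow _ _, fun t ht => ?_⟩
    rw [causalFlow_of_nonneg _ _ ht, hE S x hx]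
    exact hCb x hx t ht
  · refine ⟨_, s.representsSolution_causalFlow x, continuousOn_causalFlow _ _, fun t ht => ?_⟩
    rw [causalFlow_of_nonneg _ _ ht, hE T x hx]
    have h1 := hCb' _ (hTflow t ht x hx) t ht
    rw [flow_neg_left, flow_neg_apply_flow] at h1
    have h3 : Real.exp (ρ * t) * Real.exp (-ρ * t) = 1 := by rw [← Real.exp_add]; simp
    calc C'⁻¹ * Real.exp (ρ * t) * ‖x‖
        ≤ C'⁻¹ * Real.exp (ρ * t) * (C' * Real.exp (-ρ * t) * ‖flow s.B t x‖) := by gcongr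
      _ = ‖flow s.B t x‖ := by
          rw [← mul_assoc, mul_mul_mul_comm, inv_mul_cancel₀ hC'.ne', h3]; ring

theorem map_kerPerpProj_initialValues (hJ : s.J * M₀ = kerPerpProj M₀) :
    (initialValues M₀ M₁).map (kerPerpProj M₀ : H →ₗ[ℂ] H) = kerPerp M₀ := by
  ext y
  constructor
  · rintro ⟨x, -, rfl⟩
    exact kerPerpProj_mem M₀ x
  · intro hy
    exact ⟨s.E y, s.mem_initialValues_iff.2 (s.E_apply_E y),
      (s.kerPerpProj_E hJ y).trans (kerPerpProj_eq_self hy)⟩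

theorem map_E_kerPerp (hJ : s.J * M₀ = kerPerpProj M₀) :
    (kerPerp M₀).map (s.E : H →ₗ[ℂ] H) = initialValues M₀ M₁ := by
  ext x
  constructor
  · rintro ⟨y, -, rfl⟩
    exact s.mem_initialValues_iff.2 (s.E_apply_E y)
  · intro hx
    exact ⟨kerPerpProj M₀ x, kerPerpProj_mem M₀ x,
      (s.E_kerPerpProj hJ x).trans (s.mem_initialValues_iff.1 hx)⟩

end PencilSplitting

end Dichotomy

end OperatorPencil

end

theorem mainTheorem7 {H : Type*} [NormedAddCommGroup H] [InnerProductSpace ℂ H] [CompleteSpace H]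
    (M₀ M₁ : H →L[ℂ] H)
    (hreg : OperatorPencil.IsRegularPencil M₀ M₁)
    (hclosed : IsClosed (Set.range M₀)) :
    (OperatorPencil.AdmitsStrongDichotomy M₀ M₁ ↔ OperatorPencil.AdmitsMildDichotomy M₀ M₁) ∧
      (OperatorPencil.IsStronglyExpStable M₀ M₁ ↔ OperatorPencil.IsMildlyExpStable M₀ M₁) := by
  obtain ⟨s, hJ⟩ := OperatorPencil.exists_pencilSplitting M₀ M₁ hreg hclosed
  refine ⟨⟨fun ⟨S, T, h⟩ => ⟨_, _, s.isMildDichotomy_map hJ h⟩,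
    fun ⟨S, T, h⟩ => ⟨_, _, s.isStrongDichotomy_map hJ h⟩⟩, fun h => ?_, fun h => ?_⟩
  -- Stability is the case in which the two projections carry `IV` and `N(M₀)^⊥` onto each other and
  -- `{0}` to `{0}`.
  · have h1 := s.isMildDichotomy_map hJ h
    rwa [s.map_kerPerpProj_initialValues hJ, Submodule.map_bot] at h1
  · have h1 := s.isStrongDichotomy_map hJ h
    rwa [s.map_E_kerPerp hJ, Submodule.map_bot] at h1
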